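/- **Setting.** Player $0$ is the Controller, player $1$ the Environment; $A=A_0\uplus A_1$ are the players' regular actions. A timed game arena $G$ consists of a finite set $Q$ of locations, a finite set $E$ of edges $(q,a,g,R,q')$ with $a\in A$, $R\subseteq X$ ($X$ a finite set of clocks), invariants $C(q)$, no-wait guards $U_p(q)$ for $p\in\{0,1\}$, and colors $\alpha(q)\in\mathbb N$. Guards are Boolean combinations of constraints $x\in I$ with $x\in X$ and $I$ an interval with natural bounds. Every player $p$ has in addition a waiting action $\bot_p$, with a self-loop $(q,\bot_p,\top,\emptyset,q)$ on every location, and there is an additional clock $z$, never reset or tested. States are pairs $(q,v)$ with $v:X\cup\{z\}\to\mathbb R_{\ge 0}$ and $v\models C(q)$. For $a\in A_p\cup\{\bot_p\}$, write $(q,v)\overset{\Delta,a}{\rightharpoonup}(q',v')$ if $v+\delta\models C(q)$ for all $\delta\in[0,\Delta]$, $v+\delta\not\models U_p(q)$ for all $\delta\in(0,\Delta)$, and some edge $(q,a,g,R,q')$, self-loops included, has $v+\Delta\models g$, $v'=(v+\Delta)[R:=0]$ and $v'\models C(q')$. Player $p$ *can play* in $s$ if $s\overset{\Delta,a}{\rightharpoonup}s'$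 for some $\Delta\ge0$, $a\in A_p$, $s'$. Assume that $G$ is deadlock-free: in every state at least one player can play. **Regions.** Let $c_x$ be the largest constant to which $x$ is compared in $G$ ($0$ if there is none). Put $v\equiv v'$ if for every $x\in X$ either $v(x),v'(x)>c_x$, or $v(x),v'(x)\le c_x$ and $\lfloor v(x)\rfloor=\lfloor v'(x)\rfloor$, and if $v,v'$ induce the same weak order of fractional parts, and the same set of integer-valued clocks, on $\{x\in X: v(x)\le c_x\}\cup\{z\}$. Put $(q,v)\equiv(q',v')$ if $q=q'$ and $v\equiv v'$. **The game $\mathcal R(G)$.** The moves of player $p$ are the pairs $(\Delta,a)$ with $\Delta\ge0$, $a\in A_p\cup\{\bot_p\}$, and the move $\emptyset$ (not playing). In a state $s$ where both players can play, they propose $(\Delta_0,a_0)$ and $(\Delta_1,a_1)$, both executable from $s$, and the next state is any $s'$ with $s\overset{\Delta_j,a_j}{\rightharpoonup}s'$ for some $j$ with $\Delta_j\le\Delta_{1-j}$. In a state where player $1-p$ cannot play, player $1-p$ moves $\emptyset$ and player $p$ proposes an executable $(\Delta_p,a_p)$, which is executed. A step from $s=(q,v)$ to $s'=(q',v')$ is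 blamed on nobody if $q=q'$ and $v\not\equiv v'$; otherwise it is blamed on player $0$ if $s'$ results from the move of player $0$ (that is, $s\overset{\Delta_0,a_0}{\rightharpoonup}s'$), and on player $1$ if not. A play is time-divergent if $z$ is unbounded along it. The Controller wins a play iff it is time-divergent and the largest color visited infinitely often is even, or it is not time-divergent and only finitely many of its steps are blamed on player $0$; otherwise the Environment wins it. A strategy of $p$ maps every history (finite play prefix, from any state) to a move available to $p$ in its last state. It is winning from $s_{\mathrm{init}}$ if, for every strategy of the opponent, $p$ wins all plays from $s_{\mathrm{init}}$ that follow both strategies. **Classes of strategies.** A strategy $\sigma$ of $p$ is * *split* if $\sigma(h)=(\Delta,a)$ implies $(a\ne\bot_p\Rightarrow\Delta=0)$ and $(\Delta>0\Rightarrow a=\bot_p)$; * *$z$-stepped* if $\sigma(h)=(\Delta,a)$, with $h$ ending in $(q,v)$, implies $v(z)+\Delta\le\lfloor v(z)\rfloor+1$; * a *region strategy* if for all histories $h_1,h_2$ of the same length whose states are pairwise equivalent and whose steps have the same ticks (a step from $(q,v)$ to $(q',v')$ is a tick if $\lfloor v(z)\rfloor<\lfloor v'(z)\rfloor$), the moves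 $\sigma(h_1),\sigma(h_2)$ lead from the last states of $h_1,h_2$ to the same regions (in particular, both or neither are $\emptyset$). **Lemma (split strategies are sufficient).** Let $G$ be a deadlock-free timed game arena, $p$ a player, and suppose that, whenever $(q,v)$ is a state and $v+\delta\models C(q)$ for all $\delta\in[0,\Delta]$, if the opponent $1-p$ can play in $(q,v+\Delta)$ then $1-p$ can play in $(q,v)$ (this is automatic if $U_{1-p}\equiv\bot$, i.e. if the opponent has no no-wait constraints). Let $s_{\mathrm{init}}$ be a state. If $p$ has a winning strategy from $s_{\mathrm{init}}$ in $\mathcal R(G)$, then $p$ has a winning strategy from $s_{\mathrm{init}}$ in $\mathcal R(G)$ that is simultaneously a split strategy, a region strategy and $z$-stepped. -/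

import Mathlib

open Filter
open scoped NNReal

/-! ### Players, concurrent games on transition systems -/

/-- The two players: the Controller (Player 0) and the Environment (Player 1). -/
inductive Player where
  | controller
  | environment

/-- The opponent `1 - p` of `p`. -/
def Player.opp : Player → Player
  | .controller => .environment
  | .environment => .controller

/-- A coloured transition system whose labels are joint moves, one move for each player. -/
structure TransitionSystem (S : Type*) (M : Player → Type*) where
  tran : S → (∀ p, M p) → S → Prop
  color : S → ℕ

/-- Finite alternating sequences `s⁰ m¹ s¹ … mⁿ sⁿ`. -/
inductive History (S : Type*) (M : Player → Type*) where
  | init (s : S) : History S M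
  | snoc (h : History S M) (m : ∀ p, M p) (s : S) : History S M

/-- Infinite alternating sequences; `move i` leads from `state i` to `state (i + 1)`. -/
structure Play (S : Type*) (M : Player → Type*) where
  state : ℕ → S
  move : ℕ → ∀ p, M p

namespace History

variable {S : Type*} {M : Player → Type*}

/-- The last state of a history. -/
def last : History S M → S
  | init s => s
  | snoc _ _ s => s

end History

namespace Play

variable {S : Type*} {M : Player → Type*}

/-- The initial segment of a play up to `state i`. -/
def upTo (ρ : Play S M) : ℕ → History S M
  | 0 => .init (ρ.state 0)
  | i + 1 => .snoc (ρ.upTo i) (ρ.move i) (ρ.state (i + 1))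

end Play

namespace TransitionSystem

variable {S : Type*} {M : Player → Type*} (Φ : TransitionSystem S M)

/-- The moves available to player `p` in a state. -/
def moves (p : Player) (s : S) : Set (M p) :=
  {a | ∃ (m : ∀ p, M p) (s' : S), m p = a ∧ Φ.tran s m s'}

/-- The sequence is a history of `Φ`. -/
def IsHistory : History S M → Prop
  | .init _ => True
  | .snoc h m s => IsHistory h ∧ Φ.tran h.last m s

/-- The sequence is a play of `Φ`. -/
def IsPlay (ρ : Play S M) : Prop :=
  ∀ i, Φ.tran (ρ.state i) (ρ.move i) (ρ.state (i + 1))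

/-- A strategy of player `p` chooses, after every history, a move that is available to `p`. -/
structure Strategy (p : Player) where
  choose : History S M → M p
  available : ∀ h, Φ.IsHistory h → choose h ∈ Φ.moves p h.last

/-- The plays from `s` in which each player follows their strategy. -/
def outcome (s : S) (σ : ∀ p, Φ.Strategy p) : Set (Play S M) :=
  {ρ | Φ.IsPlay ρ ∧ ρ.state 0 = s ∧ ∀ i p, ρ.move i p = (σ p).choose (ρ.upTo i)}

/-- `ρ ⊨ Parity_even`: the largest colour that occurs infinitely often along `ρ` is even. -/
def ParityEven (ρ : Play S M) : Prop :=
  ∃ c, IsGreatest {c | ∃ᶠ i in atTop, Φ.color (ρ.state i) = c} c ∧ Even c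

end TransitionSystem

/-- A game: a transition system and the set of plays that the Controller wins. -/
structure Game (S : Type*) (M : Player → Type*) where
  ts : TransitionSystem S M
  wc : Set (Play S M)

namespace Game

variable {S : Type*} {M : Player → Type*} (𝒢 : Game S M)

/-- The objective of each player; the Environment's is the complement of the Controller's. -/
def objective : Player → Set (Play S M)
  | .controller => 𝒢.wc
  | .environment => 𝒢.wcᶜ

/-- `σ` is a winning strategy of `p` from `s`: against every strategy of the opponent, every play
of the outcome meets the objective of `p`. -/
def IsWinning {p : Player} (s : S) (σ : 𝒢.ts.Strategy p) : Prop :=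
  ∀ τ : ∀ p, 𝒢.ts.Strategy p, τ p = σ → 𝒢.ts.outcome s τ ⊆ 𝒢.objective p

end Game

/-! ### Clocks, guards, timed game arenas -/

/-- Intervals of `ℝ≥0` with natural bounds (those with lower bound above the upper bound are
empty). -/
inductive ClockInterval where
  | cc (a b : ℕ)
  | co (a b : ℕ)
  | ci (a : ℕ)
  | oc (a b : ℕ)
  | oo (a b : ℕ)
  | oi (a : ℕ)

namespace ClockInterval

/-- The set of reals denoted by an interval. -/
def toSet : ClockInterval → Set ℝ≥0
  | cc a b => Set.Icc a b
  | co a b => Set.Ico a b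
  | ci a => Set.Ici a
  | oc a b => Set.Ioc a b
  | oo a b => Set.Ioo a b
  | oi a => Set.Ioi a

/-- The constants that occur in an interval. -/
def consts : ClockInterval → Set ℕ
  | cc a b => {a, b}
  | co a b => {a, b}
  | ci a => {a}
  | oc a b => {a, b}
  | oo a b => {a, b}
  | oi a => {a}

end ClockInterval

/-- Valuations of `X_z = X ∪ {z}`; the extra clock `z` is `none`. -/
abbrev ClockVal (X : Type*) := Option X → ℝ≥0

namespace ClockVal

variable {X : Type*}

/-- The value of the extra clock `z`. -/
def z (v : ClockVal X) : ℝ≥0 := v none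

/-- `v + t`. -/
def delay (v : ClockVal X) (t : ℝ≥0) : ClockVal X := fun y => v y + t

open Classical in
/-- `v[R := 0]`, for a set `R` of clocks of `X` (so that `z` is never reset). -/
noncomputable def reset (v : ClockVal X) (R : Set X) : ClockVal X :=
  fun y => if y ∈ some '' R then 0 else v y

/-- The fractional part of the value of a clock. -/
noncomputable def frac (v : ClockVal X) (y : Option X) : ℝ := Int.fract (v y : ℝ)

end ClockVal

/-- Guards: Boolean combinations of atomic constraints `x ∈ I` on clocks of `X`. -/
inductive Guard (X : Type*) where
  | tt : Guard X
  | ff : Guard X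
  | atom (x : X) (I : ClockInterval) : Guard X
  | neg (g : Guard X) : Guard X
  | conj (g g' : Guard X) : Guard X
  | disj (g g' : Guard X) : Guard X

namespace Guard

variable {X : Type*}

/-- `v ⊨ g`. -/
def Sat (v : ClockVal X) : Guard X → Prop
  | tt => True
  | ff => False
  | atom x I => v (some x) ∈ I.toSet
  | neg g => ¬ g.Sat v
  | conj g g' => g.Sat v ∧ g'.Sat v
  | disj g g' => g.Sat v ∨ g'.Sat v

/-- The constants to which the guard compares the clock `x`. -/
def consts (x : X) : Guard X → Set ℕ
  | tt => ∅
  | ff => ∅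
  | atom y I => {c | y = x ∧ c ∈ I.consts}
  | neg g => g.consts x
  | conj g g' => g.consts x ∪ g'.consts x
  | disj g g' => g.consts x ∪ g'.consts x

end Guard

/-- Edges labelled by a regular action of one of the players; `A p` are the regular actions
of `p`, so that the disjoint union of the `A p` is the set of all actions. -/
structure ArenaEdge (Q X : Type*) (A : Player → Type*) where
  src : Q
  player : Player
  act : A player
  guard : Guard X
  resets : Set X
  tgt : Q

/-- Timed game arenas over actions `A` and clocks `X`, with set of locations `Q`. -/
structure TimedArena (Q X : Type*) (A : Player → Type*) where
  edges : Set (ArenaEdge Q X A)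
  finite_edges : edges.Finite
  inv : Q → Guard X
  noWait : Player → Q → Guard X
  color : Q → ℕ

/-- Moves of a player with set of regular actions `B`: either not playing, or proposing a delay and
an action, where the action `none` is the waiting action `⊥_p`. -/
inductive TimedMove (B : Type*) where
  | silent : TimedMove B
  | propose (Δ : ℝ≥0) (a : Option B) : TimedMove B

namespace TimedArena

variable {Q X : Type*} {A : Player → Type*} (G : TimedArena Q X A)

/-- `E_⊥`: the edges of the arena, and a self-loop `⊥_p` on every location for each player. -/
inductive ExtEdge : Q → (p : Player) → Option (A p) → Guard X → Set X → Q → Prop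
  | regular (e : ArenaEdge Q X A) (he : e ∈ G.edges) :
      ExtEdge e.src e.player (some e.act) e.guard e.resets e.tgt
  | wait (q : Q) (p : Player) : ExtEdge q p none Guard.tt ∅ q

/-- Configurations `(q, v)` that satisfy the invariant of their location. -/
structure State where
  loc : Q
  val : ClockVal X
  inv_sat : (G.inv loc).Sat val

variable {G}

/-- `(q, v) ⇀ (q', v')` by the delay `Δ` and the action `a` of player `p`. -/
def State.Step (p : Player) (s : G.State) (Δ : ℝ≥0) (a : Option (A p)) (s' : G.State) : Prop :=
  (∀ δ ≤ Δ, (G.inv s.loc).Sat (s.val.delay δ)) ∧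
  (∀ δ, 0 < δ → δ < Δ → ¬ (G.noWait p s.loc).Sat (s.val.delay δ)) ∧
  ∃ g R, G.ExtEdge s.loc p a g R s'.loc ∧ g.Sat (s.val.delay Δ) ∧
    s'.val = (s.val.delay Δ).reset R

/-- Player `p` can propose a regular action, possibly after a delay. -/
def State.Playing (p : Player) (s : G.State) : Prop :=
  ∃ (Δ : ℝ≥0) (a : A p) (s' : G.State), s.Step p Δ (some a) s'

/-- The step `s ⇀ s'` by a move of `p`; there is none if `p` does not play. -/
def State.MoveStep (p : Player) (s : G.State) : TimedMove (A p) → G.State → Prop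
  | .silent, _ => False
  | .propose Δ a, s' => s.Step p Δ a s'

variable (G)

/-- The arena is deadlock-free: in every configuration some regular action can be reached by
letting time elapse. -/
def DeadlockFree : Prop := ∀ s : G.State, ∃ p, s.Playing p

/-- If `p` can propose a regular action after time has elapsed in a location, then `p` could
already do so before. (This is automatic if the no-wait function of `p` is the empty guard.) -/
def PlayingBeforeWait (p : Player) : Prop :=
  ∀ (s s' : G.State) (Δ : ℝ≥0), s'.loc = s.loc → s'.val = s.val.delay Δ →
    (∀ δ ≤ Δ, (G.inv s.loc).Sat (s.val.delay δ)) → s'.Playing p → s.Playing p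

/-! ### Clock regions -/

/-- The guards that appear in the arena. -/
def guards : Set (Guard X) :=
  {g | (∃ e ∈ G.edges, e.guard = g) ∨ (∃ q, G.inv q = g) ∨ ∃ p q, G.noWait p q = g}

/-- `c_x`: the largest constant to which `x` is compared, `0` if there is none. -/
noncomputable def maxConst (x : X) : ℕ := sSup {c | ∃ g ∈ G.guards, c ∈ g.consts x}

/-- The clocks with value at most `c_x`, and the extra clock `z`. -/
def relevant (v : ClockVal X) : Set (Option X) :=
  {y | ∀ x, y = some x → v (some x) ≤ G.maxConst x}

/-- Clock equivalence of valuations of `X_z`. Only the fractional part of `z` matters. -/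
def ClockEquiv (v₁ v₂ : ClockVal X) : Prop :=
  (∀ x : X, (G.maxConst x < v₁ (some x) ∧ G.maxConst x < v₂ (some x)) ∨
    (v₁ (some x) ≤ G.maxConst x ∧ v₂ (some x) ≤ G.maxConst x ∧
      ⌊v₁ (some x)⌋₊ = ⌊v₂ (some x)⌋₊)) ∧
  (∀ y ∈ G.relevant v₁, ∀ y' ∈ G.relevant v₁,
    (v₁.frac y ≤ v₁.frac y' ↔ v₂.frac y ≤ v₂.frac y')) ∧
  (∀ y ∈ G.relevant v₁, (v₁.frac y = 0 ↔ v₂.frac y = 0))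

variable {G}

/-- Region equivalence of states. -/
def State.RegionEquiv (s s' : G.State) : Prop := s.loc = s'.loc ∧ G.ClockEquiv s.val s'.val

/-! ### The refined surprise semantics -/

variable (G)

/-- The transition relation of the refined surprise semantics. If both players can play, both
propose a delay and an action, and a proposal with shortest delay is executed. If a player cannot
play, the other one plays alone. -/
inductive RefinedTran : G.State → (∀ p, TimedMove (A p)) → G.State → Prop
  | both (s s' : G.State) (m : ∀ p, TimedMove (A p)) (Δ : Player → ℝ≥0) (a : ∀ p, Option (A p))
      (hm : ∀ p, m p = .propose (Δ p) (a p)) (hplay : ∀ p, s.Playing p)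
      (hstep : ∀ p, ∃ t, s.Step p (Δ p) (a p) t)
      (j : Player) (hj : Δ j ≤ Δ j.opp) (hs' : s.Step j (Δ j) (a j) s') :
      RefinedTran s m s'
  | alone (s s' : G.State) (m : ∀ p, TimedMove (A p)) (p : Player) (Δ : ℝ≥0) (a : Option (A p))
      (hp : m p = .propose Δ a) (hopp : m p.opp = .silent) (hplay : ¬ s.Playing p.opp)
      (hs' : s.Step p Δ a s') :
      RefinedTran s m s'

open Classical in
/-- The classical blame: the Controller if the step is the one that the Controller proposed, the
Environment otherwise. -/
noncomputable def blame (s : G.State) (m : ∀ p, TimedMove (A p)) (s' : G.State) : Player :=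
  if s.MoveStep .controller (m .controller) s' then .controller else .environment

open Classical in
/-- The lazy blame: nobody is blamed for a step that stays in the location and leaves the clock
region. -/
noncomputable def lazyBlame (s : G.State) (m : ∀ p, TimedMove (A p)) (s' : G.State) :
    Option Player :=
  if s'.loc = s.loc ∧ ¬ G.ClockEquiv s.val s'.val then none else some (G.blame s m s')

/-- `p` is blamed infinitely often along the play. -/
def LazilyBlamed (p : Player) (ρ : Play G.State fun p => TimedMove (A p)) : Prop :=
  ∃ᶠ i in atTop, G.lazyBlame (ρ.state i) (ρ.move i) (ρ.state (i + 1)) = some p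

/-- The clock `z` is unbounded along the play. -/
def TimeDivergent (ρ : Play G.State fun p => TimedMove (A p)) : Prop :=
  ∀ t : ℝ≥0, ∃ i, t < (ρ.state i).val.z

/-- The transition system of the refined surprise semantics. -/
def refinedTS : TransitionSystem G.State fun p => TimedMove (A p) where
  tran := G.RefinedTran
  color s := G.color s.loc

/-- The game of the refined surprise semantics. -/
def refinedGame : Game G.State fun p => TimedMove (A p) where
  ts := G.refinedTS
  wc := {ρ | G.refinedTS.IsPlay ρ ∧
    ((G.TimeDivergent ρ ∧ G.refinedTS.ParityEven ρ) ∨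
      (¬ G.TimeDivergent ρ ∧ ¬ G.LazilyBlamed .controller ρ))}

/-! ### Classes of strategies -/

variable {G}

/-- Every proposal is an immediate action or a wait. -/
def IsSplit {p : Player} (σ : G.refinedTS.Strategy p) : Prop :=
  ∀ h, G.refinedTS.IsHistory h → ∀ Δ a, σ.choose h = .propose Δ a →
    (a ≠ none → Δ = 0) ∧ (0 < Δ → a = none)

/-- No proposal lets `z` go beyond its next integer value. -/
def IsZStepped {p : Player} (σ : G.refinedTS.Strategy p) : Prop :=
  ∀ h, G.refinedTS.IsHistory h → ∀ Δ a, σ.choose h = .propose Δ a →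
    h.last.val.z + Δ ≤ ⌊h.last.val.z⌋₊ + 1

/-- Two histories have the same length and, position by position, region equivalent states. -/
def HistoryRegionEquiv : (h₁ h₂ : History G.State fun p => TimedMove (A p)) → Prop
  | .init s₁, .init s₂ => s₁.RegionEquiv s₂
  | .snoc h₁ _ s₁, .snoc h₂ _ s₂ => HistoryRegionEquiv h₁ h₂ ∧ s₁.RegionEquiv s₂
  | _, _ => False

/-- The sequence of ticks of a history, the latest one first: a step is a tick if `z` reaches a new
integer value in it. -/
noncomputable def ticks : History G.State (fun p => TimedMove (A p)) → List Bool
  | .init _ => [true]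
  | .snoc h _ s => decide (⌊h.last.val.z⌋₊ < ⌊s.val.z⌋₊) :: ticks h

/-- After region equivalent histories with the same ticks, the strategy proposes moves that lead to
the same regions (or does not play after either of them: this is the case without any `s₁`, since
the condition is symmetric in the two histories). -/
def IsRegion {p : Player} (σ : G.refinedTS.Strategy p) : Prop :=
  ∀ h₁ h₂, G.refinedTS.IsHistory h₁ → G.refinedTS.IsHistory h₂ →
    HistoryRegionEquiv h₁ h₂ → ticks h₁ = ticks h₂ →
    ∀ s₁, h₁.last.MoveStep p (σ.choose h₁) s₁ →
      ∃ s₂, h₂.last.MoveStep p (σ.choose h₂) s₂ ∧ s₁.RegionEquiv s₂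

end TimedArena

/-!
The new strategy runs a *shadow* of the given winning strategy `σ`: a history in which `p`
follows `σ` and whose current state is equivalent to the state of the actual play. When `σ`
proposes `(Δ, a)` in the shadow, the new strategy waits for the matching delay, with a stop
whenever `z` reaches an integer value, and then executes `a` without delay (`Shadow.move`).

Clock equivalence is what makes this possible. Two valuations are equivalent exactly if an
increasing bijection of `ℝ` that commutes with integer translations carries the relevant clocks
of one to those of the other, where `z` matters up to an integer only
(`ClockEquiv.exists_isClockIso`). Conjugating it by translations gives an increasing bijection
between the delays after the two valuations such that matched delays lead to equivalent
valuations and to equally many ticks (`ClockEquiv.exists_isDelayMatch`); hence all moves of the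
actual opponent have counterparts in the shadow.

Whenever `p` completes a wait, the opponent of the shadow is made to interrupt `σ` at that moment
by a wait of its own. It can do so because the actual opponent has just agreed to wait at least
as long, so that its no-wait constraint does not intervene. The only exception is an opponent who
cannot play at all. By the assumption on the opponent it will not be able to play as long as time
elapses in the location, so nothing can interrupt the proposal of `σ`, and the shadow just keeps
track of the elapsed time (`Shadow.off`) until the action is executed.

The actual play and the shadow then visit the same locations, up to finite repetition, and have
the same ticks, so that both or neither are time-divergent, with the same colours occurring
infinitely often. The step of the shadow is chosen from the entered region and the tick alone,
which makes the new strategy a region strategy (`Shadow.follow_congr`). Among the possible steps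
it is one whose blame is as bad for `p` as possible (`Shadow.next`): a shadow step that is blamed
on the Controller if `p` is the Controller, and one that is not if `p` is the Environment. The
simulation step (`Shadow.simulates`) says that, for an actual step without a tick, there is a
shadow step that is blamed on the Controller if the actual step is, respectively one that is not
if the actual step is not. Hence, if the play is not time-divergent, the blame along it is at
most (for the Controller) or at least (for the Environment) the blame along the shadow, which is
a play won by `σ` (`Shadow.mem_objective_of_shadow`).

To make the blame agree, an action of `σ` is executed at once if its delay neither leaves the
region nor includes a tick, as a preceding wait would be blamed additionally
(`Shadow.Immediate`), unless the no-wait constraint of the opponent would not let it wait for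
that delay; in this case the action never comes to be executed in the shadow either. If the
opponent cannot play and the action of `σ` can lead back to the region in which the delay ends,
then the shadow executes it as soon as that region is reached, since `p` would be blamed for
executing it separately (`Shadow.Legit`).
-/

/-! ### Periodic order automorphisms of the real line -/

/-- An order automorphism of `ℝ` that commutes with integer translations and fixes `0`; it induces
an orientation-preserving homeomorphism of the circle of fractional parts. -/
structure IsPeriodicIso (g : ℝ ≃o ℝ) : Prop where
  map_zero : g 0 = 0
  map_add_one : ∀ t, g (t + 1) = g t + 1

namespace IsPeriodicIso

variable {g k : ℝ ≃o ℝ}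

theorem refl : IsPeriodicIso (OrderIso.refl ℝ) := ⟨rfl, fun _ => rfl⟩

theorem trans (hg : IsPeriodicIso g) (hk : IsPeriodicIso k) : IsPeriodicIso (g.trans k) :=
  ⟨by simp [hg.map_zero, hk.map_zero], fun t => by simp [hg.map_add_one, hk.map_add_one]⟩

theorem symm (hg : IsPeriodicIso g) : IsPeriodicIso g.symm :=
  ⟨by rw [OrderIso.symm_apply_eq, hg.map_zero],
    fun t => by rw [OrderIso.symm_apply_eq, hg.map_add_one, g.apply_symm_apply]⟩

theorem map_add_nat (hg : IsPeriodicIso g) (t : ℝ) (n : ℕ) : g (t + n) = g t + n := by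
  induction n with
  | zero => simp
  | succ n ih => push_cast; rw [← add_assoc, hg.map_add_one, ih, add_assoc]

theorem map_add_int (hg : IsPeriodicIso g) (t : ℝ) (n : ℤ) : g (t + n) = g t + n := by
  obtain ⟨m, rfl | rfl⟩ := n.eq_nat_or_neg
  · exact_mod_cast hg.map_add_nat t m
  · have := hg.map_add_nat (t + ((-(m : ℤ) : ℤ) : ℝ)) m
    push_cast at this ⊢
    rw [neg_add_cancel_right] at this
    linarith

theorem map_int (hg : IsPeriodicIso g) (n : ℤ) : g n = n := by
  simpa [hg.map_zero] using hg.map_add_int 0 n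

theorem map_nat (hg : IsPeriodicIso g) (n : ℕ) : g n = n := by
  simpa using hg.map_int n

theorem floor_map (hg : IsPeriodicIso g) (t : ℝ) : ⌊g t⌋ = ⌊t⌋ := by
  rw [Int.floor_eq_iff]
  constructor
  · rw [← hg.map_int]; exact g.monotone (Int.floor_le t)
  · rw [← hg.map_int, ← hg.map_add_one]; exact g.strictMono (Int.lt_floor_add_one t)

theorem fract_map (hg : IsPeriodicIso g) (t : ℝ) : Int.fract (g t) = g (Int.fract t) := by
  have h := hg.map_add_int (Int.fract t) ⌊t⌋
  rw [Int.fract_add_floor] at h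
  rw [Int.fract, hg.floor_map, h]; ring

/-- Conjugating by a translation: the automorphism seen from the base point `-δ`. -/
theorem shift (hg : IsPeriodicIso g) (δ : ℝ) :
    IsPeriodicIso (((OrderIso.addRight (-δ)).trans g).trans (OrderIso.addRight (-g (-δ)))) := by
  refine ⟨by simp, fun t => ?_⟩
  have : t + 1 + -δ = t + -δ + 1 := by ring
  simp only [OrderIso.trans_apply, OrderIso.addRight_apply]
  rw [this, hg.map_add_one]; ring

end IsPeriodicIso

/-- A bijective increasing self-map of `[0, 1)` extends to a periodic automorphism. -/
theorem exists_isPeriodicIso_of_Ico {κ l : ℝ → ℝ} (hκ : StrictMonoOn κ (Set.Ico 0 1))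
    (hmaps : Set.MapsTo κ (Set.Ico 0 1) (Set.Ico 0 1))
    (hl : Set.MapsTo l (Set.Ico 0 1) (Set.Ico 0 1))
    (hinv : ∀ t ∈ Set.Ico (0 : ℝ) 1, κ (l t) = t) (h0 : κ 0 = 0) :
    ∃ g : ℝ ≃o ℝ, IsPeriodicIso g ∧ ∀ t ∈ Set.Ico (0 : ℝ) 1, g t = κ t := by
  have hf : ∀ t : ℝ, Int.fract t ∈ Set.Ico (0 : ℝ) 1 :=
    fun t => ⟨Int.fract_nonneg t, Int.fract_lt_one t⟩
  let K : ℝ → ℝ := fun t => ⌊t⌋ + κ (Int.fract t)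
  have hmono : StrictMono K := by
    intro s t hst
    have h1 := hmaps (hf s)
    have h2 := hmaps (hf t)
    rcases (Int.floor_le_floor hst.le).lt_or_eq with h | h
    · have : (⌊s⌋ : ℝ) + 1 ≤ ⌊t⌋ := by exact_mod_cast h
      simp only [K]; linarith [h1.2, h2.1]
    · have : κ (Int.fract s) < κ (Int.fract t) := by
        apply hκ (hf s) (hf t)
        rw [Int.fract, Int.fract, h]; linarith
      simp only [K]; rw [h]; linarith
  have hsurj : Function.Surjective K := by
    intro w
    have h := hl (hf w)
    refine ⟨⌊w⌋ + l (Int.fract w), ?_⟩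
    have h1 : Int.fract (⌊w⌋ + l (Int.fract w)) = l (Int.fract w) := by
      rw [Int.fract_intCast_add, Int.fract_eq_self.2 h]
    have h2 : ⌊(⌊w⌋ + l (Int.fract w) : ℝ)⌋ = ⌊w⌋ := by
      rw [Int.floor_intCast_add, Int.floor_eq_zero_iff.2 h, add_zero]
    simp only [K]
    rw [h1, h2, hinv _ (hf w), Int.floor_add_fract]
  refine ⟨StrictMono.orderIsoOfSurjective K hmono hsurj, ⟨?_, fun t => ?_⟩, fun t ht => ?_⟩
  · simp [K, h0]
  · simp only [StrictMono.coe_orderIsoOfSurjective, K]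
    rw [Int.floor_add_one, Int.fract_add_one]; push_cast; ring
  · simp only [StrictMono.coe_orderIsoOfSurjective, K]
    rw [Int.floor_eq_zero_iff.2 ht, Int.fract_eq_self.2 ht]; simp

/-- The piecewise linear self-map of `[0, 1]` that is the identity up to `c` and sends `a` to
`b`. -/
noncomputable def bendMap (c a b t : ℝ) : ℝ :=
  if t ≤ c then t else if t ≤ a then c + (t - c) * ((b - c) / (a - c))
  else b + (t - a) * ((1 - b) / (1 - a))

section bendMap

variable {c a b : ℝ}

theorem strictMono_bendMap (hca : c < a) (ha : a < 1) (hcb : c < b) (hb : b < 1) :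
    StrictMono (bendMap c a b) := by
  have h1 : 0 < (b - c) / (a - c) := div_pos (by linarith) (by linarith)
  have h2 : 0 < (1 - b) / (1 - a) := div_pos (by linarith) (by linarith)
  have h3 : (a - c) * ((b - c) / (a - c)) = b - c := mul_div_cancel₀ _ (by linarith)
  intro s t hst
  have key : ∀ u, c < u → u ≤ a → c < c + (u - c) * ((b - c) / (a - c)) ∧
      c + (u - c) * ((b - c) / (a - c)) ≤ b := fun u hu hu' =>
    ⟨by linarith [mul_pos (sub_pos.2 hu) h1],
      by linarith [mul_le_mul_of_nonneg_right (sub_le_sub_right hu' c) h1.le]⟩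
  have key' : ∀ u, a < u → b < b + (u - a) * ((1 - b) / (1 - a)) := fun u hu => by
    linarith [mul_pos (sub_pos.2 hu) h2]
  unfold bendMap
  split_ifs with hs ht hta hsa
  · exact hst
  · linarith [(key t (by linarith) hta).1]
  · linarith [key' t (by linarith)]
  · linarith
  · linarith [mul_lt_mul_of_pos_right (sub_lt_sub_right hst c) h1]
  · linarith [(key s (by linarith) hsa).2, key' t (by linarith)]
  · linarith
  · linarith
  · linarith [mul_lt_mul_of_pos_right (sub_lt_sub_right hst a) h2]

theorem bendMap_self (hca : c < a) : bendMap c a b a = b := by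
  rw [bendMap, if_neg hca.not_ge, if_pos le_rfl, mul_div_cancel₀ _ (by linarith)]; ring

theorem bendMap_one (hca : c < a) (ha : a < 1) : bendMap c a b 1 = 1 := by
  rw [bendMap, if_neg (by linarith), if_neg (by linarith), mul_div_cancel₀ _ (by linarith)]; ring

theorem bendMap_of_le {t : ℝ} (ht : t ≤ c) : bendMap c a b t = t := if_pos ht

theorem bendMap_bendMap (hca : c < a) (ha : a < 1) (hcb : c < b) (hb : b < 1) (t : ℝ) :
    bendMap c a b (bendMap c b a t) = t := by
  rcases le_or_gt t c with ht | ht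
  · rw [bendMap_of_le ht, bendMap_of_le ht]
  have m := strictMono_bendMap hcb hb hca ha
  have h1 : c < bendMap c b a t := by
    have := m ht; rwa [bendMap_of_le le_rfl] at this
  have e1 : a - c ≠ 0 := by linarith
  have e2 : b - c ≠ 0 := by linarith
  have e3 : 1 - a ≠ 0 := by linarith
  have e4 : 1 - b ≠ 0 := by linarith
  rcases le_or_gt t b with htb | htb
  · have h2 : bendMap c b a t ≤ a := by
      have := m.monotone htb; rwa [bendMap_self hcb] at this
    rw [bendMap, if_neg h1.not_ge, if_pos h2, bendMap, if_neg ht.not_ge, if_pos htb]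
    field_simp; ring
  · have h2 : a < bendMap c b a t := by
      have := m htb; rwa [bendMap_self hcb] at this
    rw [bendMap, if_neg h1.not_ge, if_neg h2.not_ge, bendMap, if_neg ht.not_ge, if_neg htb.not_ge]
    field_simp; ring

end bendMap

theorem exists_isPeriodicIso_bend {c a b : ℝ} (hc : 0 ≤ c) (hca : c < a) (ha : a < 1)
    (hcb : c < b) (hb : b < 1) :
    ∃ g : ℝ ≃o ℝ, IsPeriodicIso g ∧ (∀ t, 0 ≤ t → t ≤ c → g t = t) ∧ g a = b := by
  have maps : ∀ {a b : ℝ}, c < a → a < 1 → c < b → b < 1 →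
      Set.MapsTo (bendMap c a b) (Set.Ico 0 1) (Set.Ico 0 1) := by
    intro a b hca ha hcb hb t ht
    have m := strictMono_bendMap hca ha hcb hb
    refine ⟨?_, ?_⟩
    · have := m.monotone ht.1; rwa [bendMap_of_le hc] at this
    · have := m ht.2; rwa [bendMap_one hca ha] at this
  obtain ⟨g, hg, h⟩ := exists_isPeriodicIso_of_Ico
    ((strictMono_bendMap hca ha hcb hb).strictMonoOn _) (maps hca ha hcb hb) (maps hcb hb hca ha)
    (fun t _ => bendMap_bendMap hca ha hcb hb t) (bendMap_of_le hc)
  refine ⟨g, hg, fun t h0 htc => ?_, ?_⟩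
  · rw [h t ⟨h0, by linarith⟩, bendMap_of_le htc]
  · rw [h a ⟨by linarith, ha⟩, bendMap_self hca]

/-- Two families of points of the circle with the same order relations, also relative to `0`, are
related by a periodic automorphism. The points are added in increasing order: each new one is moved
to its place by an automorphism that is the identity below it. -/
theorem exists_isPeriodicIso {ι : Type*} (S : Finset ι) (a b : ι → ℝ)
    (ha : ∀ i ∈ S, a i ∈ Set.Ico (0 : ℝ) 1) (hb : ∀ i ∈ S, b i ∈ Set.Ico (0 : ℝ) 1)
    (h : ∀ i ∈ S, ∀ j ∈ S, (a i ≤ a j ↔ b i ≤ b j)) (h0 : ∀ i ∈ S, (a i = 0 ↔ b i = 0)) :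
    ∃ g : ℝ ≃o ℝ, IsPeriodicIso g ∧ ∀ i ∈ S, g (a i) = b i := by
  classical
  induction S using Finset.induction_on_max_value a with
  | empty => exact ⟨OrderIso.refl ℝ, .refl, by simp⟩
  | insert i s his hmax ih =>
    have hsub := Finset.subset_insert i s
    obtain ⟨g, hg, hgs⟩ := ih (fun j hj => ha j (hsub hj)) (fun j hj => hb j (hsub hj))
      (fun j hj k hk => h j (hsub hj) k (hsub hk)) (fun j hj => h0 j (hsub hj))
    have hi := Finset.mem_insert_self i s
    by_cases hib : g (a i) = b i
    · exact ⟨g, hg, by simpa [hib] using hgs⟩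
    have hai : 0 < a i := lt_of_le_of_ne (ha i hi).1 fun e => hib <| by
      rw [← e, hg.map_zero, eq_comm, ← h0 i hi, ← e]
    have hbi : 0 < b i := lt_of_le_of_ne (hb i hi).1 fun e => hai.ne' ((h0 i hi).2 e.symm)
    have hlt : ∀ j ∈ s, b j < b i ∧ b j < g (a i) := by
      intro j hj
      have hne : ¬ a i ≤ a j := fun hle => hib <| by
        have e : a i = a j := le_antisymm hle (hmax j hj)
        rw [e, hgs j hj]
        exact le_antisymm ((h j (hsub hj) i hi).1 e.ge) ((h i hi j (hsub hj)).1 e.le)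
      refine ⟨not_le.1 fun hle => hne ((h i hi j (hsub hj)).2 hle), ?_⟩
      rw [← hgs j hj]
      exact g.strictMono (not_le.1 hne)
    have hne : (insert 0 (s.image b)).Nonempty := ⟨0, by simp⟩
    have hg0 : 0 < g (a i) := by rw [← hg.map_zero]; exact g.strictMono hai
    have hg1 : g (a i) < 1 := by
      have := hg.map_int 1
      rw [Int.cast_one] at this
      rw [← this]; exact g.strictMono (ha i hi).2
    obtain ⟨k, hk, hkid, hka⟩ := exists_isPeriodicIso_bend (c := (insert 0 (s.image b)).max' hne)
      (a := g (a i)) (b := b i) (Finset.le_max' _ _ (by simp))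
      (by rw [Finset.max'_lt_iff]; simpa [hg0] using fun j hj => (hlt j hj).2) hg1
      (by rw [Finset.max'_lt_iff]; simpa [hbi] using fun j hj => (hlt j hj).1) (hb i hi).2
    refine ⟨g.trans k, hg.trans hk, fun j hj => ?_⟩
    rcases Finset.mem_insert.1 hj with rfl | hj
    · exact hka
    · rw [OrderIso.trans_apply, hgs j hj]
      exact hkid _ (hb j (hsub hj)).1 (Finset.le_max' _ _ (by simpa using Or.inr ⟨j, hj, rfl⟩))

/-! ### Clock equivalence through periodic automorphisms -/

namespace ClockVal

variable {X : Type*}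

@[simp] theorem delay_zero (v : ClockVal X) : v.delay 0 = v := by
  funext y; simp [delay]

theorem delay_delay (v : ClockVal X) (s t : ℝ≥0) : (v.delay s).delay t = v.delay (s + t) := by
  funext y; simp [delay, add_assoc]

@[simp] theorem z_delay (v : ClockVal X) (t : ℝ≥0) : (v.delay t).z = v.z + t := rfl

@[simp] theorem z_reset (v : ClockVal X) (R : Set X) : (v.reset R).z = v.z := by
  simp [reset, z]

open Classical in
theorem reset_some (v : ClockVal X) (R : Set X) (x : X) :
    v.reset R (some x) = if x ∈ R then 0 else v (some x) := by
  simp [reset]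

@[simp] theorem reset_empty (v : ClockVal X) : v.reset ∅ = v := by
  funext y; simp [reset]

end ClockVal

theorem natCast_floor_coe (a : ℝ≥0) : ((⌊a⌋₊ : ℤ)) = ⌊(a : ℝ)⌋ := by
  rw [eq_comm, Int.floor_eq_iff]
  exact ⟨by exact_mod_cast Nat.floor_le a.2, by exact_mod_cast Nat.lt_floor_add_one a⟩

namespace TimedArena

variable {Q X : Type*} {A : Player → Type*} (G : TimedArena Q X A)

/-- The periodic automorphism `g` carries the relevant clocks of `v` to those of `w`, where the
extra clock only matters up to an integer. -/
structure IsClockIso (g : ℝ ≃o ℝ) (v w : ClockVal X) : Prop where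
  periodic : IsPeriodicIso g
  clock : ∀ x : X, (G.maxConst x < v (some x) ∧ G.maxConst x < w (some x)) ∨
    (v (some x) ≤ G.maxConst x ∧ w (some x) ≤ G.maxConst x ∧ g (v (some x)) = w (some x))
  extra : ∃ k : ℤ, g v.z = w.z + k

variable {G} {g k : ℝ ≃o ℝ} {u v w : ClockVal X}

namespace IsClockIso

theorem refl (v : ClockVal X) : G.IsClockIso (OrderIso.refl ℝ) v v :=
  ⟨.refl, fun x => (lt_or_ge _ _).imp (fun h => ⟨h, h⟩) fun h => ⟨h, h, rfl⟩, 0, by simp⟩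

theorem symm (h : G.IsClockIso g v w) : G.IsClockIso g.symm w v := by
  refine ⟨h.periodic.symm, fun x => ?_, ?_⟩
  · rcases h.clock x with h1 | ⟨h1, h2, h3⟩
    · exact .inl h1.symm
    · exact .inr ⟨h2, h1, by rw [← h3, g.symm_apply_apply]⟩
  · obtain ⟨k, hk⟩ := h.extra
    refine ⟨-k, ?_⟩
    have e : (w.z : ℝ) = g v.z + (-k : ℤ) := by push_cast; linarith
    rw [e, h.periodic.symm.map_add_int, g.symm_apply_apply]

theorem trans (h : G.IsClockIso g u v) (h' : G.IsClockIso k v w) :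
    G.IsClockIso (g.trans k) u w := by
  refine ⟨h.periodic.trans h'.periodic, fun x => ?_, ?_⟩
  · rcases h.clock x with ⟨h1, h2⟩ | ⟨h1, h2, h3⟩ <;>
    rcases h'.clock x with ⟨h4, h5⟩ | ⟨h4, h5, h6⟩
    · exact .inl ⟨h1, h5⟩
    · exact absurd h2 h4.not_gt
    · exact absurd h4 h2.not_gt
    · exact .inr ⟨h1, h5, by rw [OrderIso.trans_apply, h3, h6]⟩
  · obtain ⟨a, ha⟩ := h.extra
    obtain ⟨b, hb⟩ := h'.extra
    refine ⟨b + a, ?_⟩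
    rw [OrderIso.trans_apply, ha, h'.periodic.map_add_int, hb]; push_cast; ring

theorem frac_eq (h : G.IsClockIso g v w) {y : Option X} (hy : y ∈ G.relevant v) :
    w.frac y = g (v.frac y) := by
  unfold ClockVal.frac
  rw [← h.periodic.fract_map]
  cases y with
  | none =>
    obtain ⟨k, hk⟩ := h.extra
    change Int.fract (w.z : ℝ) = Int.fract (g v.z)
    rw [hk, Int.fract_add_intCast]
  | some x =>
    rcases h.clock x with ⟨h1, -⟩ | ⟨-, -, h3⟩
    · exact absurd (hy x rfl) h1.not_ge
    · rw [h3]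

/-- Comparisons with the constants of the arena are preserved. -/
theorem le_iff (h : G.IsClockIso g v w) (x : X) {n : ℕ} (hn : n ≤ G.maxConst x) :
    ((n : ℝ≥0) ≤ v (some x) ↔ (n : ℝ≥0) ≤ w (some x)) ∧
      (v (some x) ≤ n ↔ w (some x) ≤ n) := by
  have hn' : (n : ℝ≥0) ≤ G.maxConst x := by exact_mod_cast hn
  rcases h.clock x with ⟨h1, h2⟩ | ⟨-, -, h3⟩
  · exact ⟨iff_of_true (hn'.trans_lt h1).le (hn'.trans_lt h2).le,
      iff_of_false (hn'.trans_lt h1).not_ge (hn'.trans_lt h2).not_ge⟩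
  · have e := h.periodic.map_nat n
    simp only [← NNReal.coe_le_coe, NNReal.coe_natCast, ← h3]
    constructor
    · rw [← g.le_iff_le, e]
    · rw [← g.le_iff_le, e]

theorem clockEquiv (h : G.IsClockIso g v w) : G.ClockEquiv v w := by
  refine ⟨fun x => ?_, fun y hy y' hy' => ?_, fun y hy => ?_⟩
  · rcases h.clock x with h1 | ⟨h1, h2, h3⟩
    · exact .inl h1
    refine .inr ⟨h1, h2, ?_⟩
    zify
    rw [natCast_floor_coe, natCast_floor_coe, ← h3, h.periodic.floor_map]
  · rw [h.frac_eq hy, h.frac_eq hy', g.le_iff_le]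
  · rw [h.frac_eq hy]
    nth_rw 2 [← h.periodic.map_zero]
    rw [g.injective.eq_iff]

theorem reset (h : G.IsClockIso g v w) (R : Set X) : G.IsClockIso g (v.reset R) (w.reset R) := by
  refine ⟨h.periodic, fun x => ?_, by simpa using h.extra⟩
  rw [ClockVal.reset_some, ClockVal.reset_some]
  split_ifs with hx
  · exact .inr ⟨zero_le, zero_le, by simp [h.periodic.map_zero]⟩
  · exact h.clock x

theorem delay (h : G.IsClockIso g v w) {δ δ' : ℝ≥0} (hδ : (δ' : ℝ) = -g (-δ)) :
    G.IsClockIso (((OrderIso.addRight (-δ : ℝ)).trans g).trans (OrderIso.addRight (-g (-δ))))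
      (v.delay δ) (w.delay δ') := by
  have key : ∀ t : ℝ, (((OrderIso.addRight (-δ : ℝ)).trans g).trans
      (OrderIso.addRight (-g (-δ)))) (t + δ) = g t + δ' := fun t => by simp [hδ]
  refine ⟨h.periodic.shift _, fun x => ?_, ?_⟩
  · simp only [ClockVal.delay]
    rcases h.clock x with ⟨h1, h2⟩ | ⟨-, -, h3⟩
    · exact .inl ⟨h1.trans_le le_self_add, h2.trans_le le_self_add⟩
    · have e : (((OrderIso.addRight (-δ : ℝ)).trans g).trans (OrderIso.addRight (-g (-δ))))
          ((v (some x) + δ : ℝ≥0) : ℝ) = (w (some x) + δ' : ℝ≥0) := by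
        push_cast; rw [key, h3]
      have hle : v (some x) + δ ≤ G.maxConst x ↔ w (some x) + δ' ≤ G.maxConst x := by
        rw [← NNReal.coe_le_coe, ← NNReal.coe_le_coe, ← e, NNReal.coe_natCast]
        nth_rw 2 [← (h.periodic.shift δ).map_nat (G.maxConst x)]
        rw [OrderIso.le_iff_le]
      by_cases hc : v (some x) + δ ≤ G.maxConst x
      · exact .inr ⟨hc, hle.1 hc, e⟩
      · exact .inl ⟨not_le.1 hc, not_le.1 (mt hle.2 hc)⟩
  · obtain ⟨k, hk⟩ := h.extra
    refine ⟨k, ?_⟩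
    rw [ClockVal.z_delay, ClockVal.z_delay, NNReal.coe_add, key, hk]; push_cast; ring

end IsClockIso

/-- Every clock equivalence is induced by a periodic automorphism of the real line. -/
theorem ClockEquiv.exists_isClockIso [Finite X] (h : G.ClockEquiv v w) :
    ∃ g, G.IsClockIso g v w := by
  obtain ⟨g, hg, hgs⟩ := exists_isPeriodicIso (Set.toFinite (G.relevant v)).toFinset v.frac w.frac
    (fun i _ => ⟨Int.fract_nonneg _, Int.fract_lt_one _⟩)
    (fun i _ => ⟨Int.fract_nonneg _, Int.fract_lt_one _⟩)
    (fun i hi j hj => h.2.1 i (by simpa using hi) j (by simpa using hj))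
    (fun i hi => h.2.2 i (by simpa using hi))
  have key : ∀ y ∈ G.relevant v, g (v y) = ⌊(v y : ℝ)⌋ + Int.fract (w y : ℝ) := fun y hy => by
    have e := hgs y (by simpa using hy)
    rw [← Int.fract_add_floor (v y : ℝ), hg.map_add_int, Int.floor_add_intCast]
    unfold ClockVal.frac at e
    simp [e, add_comm]
  refine ⟨g, hg, fun x => ?_, ?_⟩
  · rcases h.1 x with h1 | ⟨h1, h2, h3⟩
    · exact .inl h1
    refine .inr ⟨h1, h2, ?_⟩
    rw [key _ (by rintro _ ⟨⟩; exact h1), ← natCast_floor_coe, h3, natCast_floor_coe,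
      Int.floor_add_fract]
  · refine ⟨⌊(v.z : ℝ)⌋ - ⌊(w.z : ℝ)⌋, ?_⟩
    have e := key none (by rintro _ ⟨⟩)
    change g v.z = _
    rw [ClockVal.z, e]
    push_cast
    rw [Int.fract, ClockVal.z]; ring

namespace ClockEquiv

theorem refl (v : ClockVal X) : G.ClockEquiv v v := (IsClockIso.refl v).clockEquiv

variable [Finite X]

theorem symm (h : G.ClockEquiv v w) : G.ClockEquiv w v :=
  let ⟨_, hg⟩ := h.exists_isClockIso
  hg.symm.clockEquiv

theorem trans (h : G.ClockEquiv u v) (h' : G.ClockEquiv v w) : G.ClockEquiv u w :=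
  let ⟨_, hg⟩ := h.exists_isClockIso
  let ⟨_, hk⟩ := h'.exists_isClockIso
  (hg.trans hk).clockEquiv

theorem reset (h : G.ClockEquiv v w) (R : Set X) : G.ClockEquiv (v.reset R) (w.reset R) :=
  let ⟨_, hg⟩ := h.exists_isClockIso
  (hg.reset R).clockEquiv

theorem le_iff (h : G.ClockEquiv v w) (x : X) {n : ℕ} (hn : n ≤ G.maxConst x) :
    ((n : ℝ≥0) ≤ v (some x) ↔ (n : ℝ≥0) ≤ w (some x)) ∧
      (v (some x) ≤ n ↔ w (some x) ≤ n) :=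
  let ⟨_, hg⟩ := h.exists_isClockIso
  hg.le_iff x hn

theorem eq_zero_iff (h : G.ClockEquiv v w) (x : X) : v (some x) = 0 ↔ w (some x) = 0 := by
  simpa using (h.le_iff x (Nat.zero_le _)).2

/-- Equivalent valuations have coinciding resets at the same time. -/
theorem reset_eq_reset (h : G.ClockEquiv v w) {R R' : Set X} (e : v.reset R = v.reset R') :
    w.reset R = w.reset R' := by
  funext y
  cases y with
  | none => exact (ClockVal.z_reset w R).trans (ClockVal.z_reset w R').symm
  | some x =>
    have e := congrFun e (some x)
    have h := h.eq_zero_iff x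
    rw [ClockVal.reset_some, ClockVal.reset_some] at e ⊢
    split_ifs at e ⊢
    · rfl
    · exact (h.1 e.symm).symm
    · exact h.1 e
    · rfl

end ClockEquiv

variable (G)

/-- `φ` matches the delays after `v` with the delays after `w`: matched delays lead to equivalent
valuations and let `z` pass the same number of integers. -/
def IsDelayMatch (v w : ClockVal X) (φ : ℝ≥0 ≃o ℝ≥0) : Prop :=
  ∀ δ, G.ClockEquiv (v.delay δ) (w.delay (φ δ)) ∧
    ⌊v.z + δ⌋₊ + ⌊w.z⌋₊ = ⌊w.z + φ δ⌋₊ + ⌊v.z⌋₊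

variable {G}

/-- If `g` carries the clocks of `v` to those of `w`, then the delays are matched by
`δ ↦ -g (-δ)`. -/
theorem ClockEquiv.exists_isDelayMatch [Finite X] (h : G.ClockEquiv v w) :
    ∃ φ, G.IsDelayMatch v w φ := by
  obtain ⟨g, hg⟩ := h.exists_isClockIso
  have nonneg : ∀ {g : ℝ ≃o ℝ}, IsPeriodicIso g → ∀ δ : ℝ≥0, 0 ≤ -g (-δ) := by
    intro g hg δ
    have : g (-δ) ≤ g 0 := g.monotone (by simp)
    rw [hg.map_zero] at this
    linarith
  let φ : ℝ≥0 ≃ ℝ≥0 :=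
    { toFun := fun δ => NNReal.mk (-g (-δ)) (nonneg hg.periodic δ)
      invFun := fun δ => NNReal.mk (-g.symm (-δ)) (nonneg hg.periodic.symm δ)
      left_inv := fun δ => NNReal.eq (by simp)
      right_inv := fun δ => NNReal.eq (by simp) }
  refine ⟨⟨φ, ?_⟩, fun δ => ?_⟩
  · intro a b
    rw [← NNReal.coe_le_coe]
    change -g (-a) ≤ -g (-b) ↔ a ≤ b
    simp
  · have hd := hg.delay (δ := δ) (δ' := φ δ) rfl
    refine ⟨hd.clockEquiv, ?_⟩
    obtain ⟨k, hk⟩ := hg.extra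
    have h1 := hg.periodic.floor_map v.z
    have h2 := hd.periodic.floor_map (v.z + δ)
    simp only [OrderIso.trans_apply, OrderIso.addRight_apply] at h2
    have e : g (v.z + δ + -δ) + -g (-δ) = (w.z + φ δ : ℝ) + k := by
      rw [add_neg_cancel_right, hk]
      change _ + ((φ δ : ℝ≥0) : ℝ) = _
      ring
    rw [hk, Int.floor_add_intCast] at h1
    rw [e, Int.floor_add_intCast] at h2
    change ⌊v.z + δ⌋₊ + ⌊w.z⌋₊ = ⌊w.z + φ δ⌋₊ + ⌊v.z⌋₊
    zify
    simp only [natCast_floor_coe]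
    push_cast
    linarith

namespace IsDelayMatch

variable {φ : ℝ≥0 ≃o ℝ≥0}

theorem clockEquiv (h : G.IsDelayMatch v w φ) (δ : ℝ≥0) :
    G.ClockEquiv (v.delay δ) (w.delay (φ δ)) := (h δ).1

theorem tick_iff (h : G.IsDelayMatch v w φ) (δ : ℝ≥0) :
    ⌊v.z⌋₊ < ⌊v.z + δ⌋₊ ↔ ⌊w.z⌋₊ < ⌊w.z + φ δ⌋₊ := by
  have := (h δ).2
  omega

end IsDelayMatch

/-! ### Guards -/

theorem _root_.ClockInterval.mem_toSet_iff {I : ClockInterval} {a b : ℝ≥0}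
    (h : ∀ n ∈ I.consts, ((n : ℝ≥0) ≤ a ↔ (n : ℝ≥0) ≤ b) ∧ (a ≤ n ↔ b ≤ n)) :
    a ∈ I.toSet ↔ b ∈ I.toSet := by
  have h' : ∀ n ∈ I.consts, ((n : ℝ≥0) < a ↔ (n : ℝ≥0) < b) ∧ (a < n ↔ b < n) := fun n hn =>
    ⟨by rw [← not_le, ← not_le, (h n hn).2], by rw [← not_le, ← not_le, (h n hn).1]⟩
  cases I <;>
  simp only [ClockInterval.consts, Set.mem_insert_iff, Set.mem_singleton_iff,
    forall_eq_or_imp, forall_eq]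
    at h h' <;>
  simp only [ClockInterval.toSet, Set.mem_Icc, Set.mem_Ico, Set.mem_Ioc, Set.mem_Ioo,
    Set.mem_Ici, Set.mem_Ioi, h, h']

theorem _root_.Guard.sat_iff {g : Guard X} (h : ∀ x, ∀ n ∈ g.consts x,
    ((n : ℝ≥0) ≤ v (some x) ↔ (n : ℝ≥0) ≤ w (some x)) ∧ (v (some x) ≤ n ↔ w (some x) ≤ n)) :
    g.Sat v ↔ g.Sat w := by
  induction g with
  | tt => rfl
  | ff => rfl
  | atom x I => exact ClockInterval.mem_toSet_iff fun n hn => h x n ⟨rfl, hn⟩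
  | neg g ih => exact not_congr (ih h)
  | conj g g' ih ih' =>
    exact and_congr (ih fun x n hn => h x n (.inl hn)) (ih' fun x n hn => h x n (.inr hn))
  | disj g g' ih ih' =>
    exact or_congr (ih fun x n hn => h x n (.inl hn)) (ih' fun x n hn => h x n (.inr hn))

theorem _root_.ClockInterval.finite_consts (I : ClockInterval) : I.consts.Finite := by
  cases I <;> simp [ClockInterval.consts]

theorem _root_.Guard.finite_consts (g : Guard X) (x : X) : (g.consts x).Finite := by
  induction g with
  | tt => exact Set.finite_empty
  | ff => exact Set.finite_empty
  | atom y I => exact I.finite_consts.subset fun _ h => h.2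
  | neg g ih => exact ih
  | conj g g' ih ih' => exact ih.union ih'
  | disj g g' ih ih' => exact ih.union ih'

instance : Finite Player :=
  Finite.of_injective (fun p => (Player.casesOn p true false : Bool)) fun p q h => by
    cases p <;> cases q <;> first | rfl | simp at h

variable (G) in
theorem finite_guards [Finite Q] : G.guards.Finite := by
  refine ((G.finite_edges.image ArenaEdge.guard).union ((Set.finite_range G.inv).union
    (Set.finite_range fun x : Player × Q => G.noWait x.1 x.2))).subset ?_
  rintro g (⟨e, he, rfl⟩ | ⟨q, rfl⟩ | ⟨p, q, rfl⟩)
  · exact .inl ⟨e, he, rfl⟩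
  · exact .inr (.inl ⟨q, rfl⟩)
  · exact .inr (.inr ⟨(p, q), rfl⟩)

theorem le_maxConst [Finite Q] {g : Guard X} (hg : g ∈ G.guards) {x : X} {n : ℕ}
    (hn : n ∈ g.consts x) : n ≤ G.maxConst x := by
  refine le_csSup (Set.Finite.bddAbove ?_) ⟨g, hg, hn⟩
  refine (G.finite_guards.biUnion fun g _ => g.finite_consts x).subset ?_
  rintro c ⟨g, hg, hc⟩
  exact Set.mem_biUnion hg hc

theorem ClockEquiv.sat_iff [Finite Q] [Finite X] (h : G.ClockEquiv v w) {g : Guard X}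
    (hg : g ∈ G.guards) : g.Sat v ↔ g.Sat w :=
  Guard.sat_iff fun x _ hn => h.le_iff x (le_maxConst hg hn)

theorem ClockEquiv.inv_iff [Finite Q] [Finite X] (h : G.ClockEquiv v w) (q : Q) :
    (G.inv q).Sat v ↔ (G.inv q).Sat w :=
  h.sat_iff (.inr (.inl ⟨q, rfl⟩))

theorem ClockEquiv.noWait_iff [Finite Q] [Finite X] (h : G.ClockEquiv v w) (p : Player) (q : Q) :
    (G.noWait p q).Sat v ↔ (G.noWait p q).Sat w :=
  h.sat_iff (.inr (.inr ⟨p, q, rfl⟩))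

/-- Guards are constant along a delay that returns to the same region. -/
theorem ClockEquiv.noWait_delay_iff [Finite Q] [Finite X] {s t t' : ℝ≥0} (hst : s ≤ t)
    (htt' : t ≤ t') (h : G.ClockEquiv (v.delay s) (v.delay t')) (p : Player) (q : Q) :
    (G.noWait p q).Sat (v.delay s) ↔ (G.noWait p q).Sat (v.delay t) := by
  refine Guard.sat_iff fun x n hn => ?_
  have h := h.le_iff x (le_maxConst (.inr (.inr ⟨p, q, rfl⟩)) hn)
  have h1 : v (some x) + s ≤ v (some x) + t := by gcongr
  have h2 : v (some x) + t ≤ v (some x) + t' := by gcongr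
  simp only [ClockVal.delay] at h ⊢
  exact ⟨⟨fun e => e.trans h1, fun e => h.1.2 (e.trans h2)⟩,
    ⟨fun e => h2.trans (h.2.1 e), fun e => h1.trans e⟩⟩

end TimedArena

/-! ### Joint moves -/

@[simp] theorem Player.opp_opp (p : Player) : p.opp.opp = p := by cases p <;> rfl

theorem Player.forall_iff {P : Player → Prop} (p : Player) : (∀ q, P q) ↔ P p ∧ P p.opp := by
  refine ⟨fun h => ⟨h _, h _⟩, fun ⟨h, h'⟩ q => ?_⟩
  cases p <;> cases q <;> first | exact h | exact h'

theorem Player.exists_joint {B : Player → Type*} (p : Player) (x : B p) (y : B p.opp) :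
    ∃ m : ∀ q, B q, m p = x ∧ m p.opp = y := by
  cases p
  · exact ⟨fun q => match q with | .controller => x | .environment => y, rfl, rfl⟩
  · exact ⟨fun q => match q with | .controller => y | .environment => x, rfl, rfl⟩

namespace TimedArena

variable {Q X : Type*} {A : Player → Type*} {G : TimedArena Q X A}

/-! ### Steps and regions -/

namespace State

theorem RegionEquiv.refl (s : G.State) : s.RegionEquiv s := ⟨rfl, .refl _⟩

theorem RegionEquiv.symm [Finite X] {s t : G.State} (h : s.RegionEquiv t) : t.RegionEquiv s :=
  ⟨h.1.symm, h.2.symm⟩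

theorem RegionEquiv.trans [Finite X] {s t u : G.State} (h : s.RegionEquiv t)
    (h' : t.RegionEquiv u) : s.RegionEquiv u :=
  ⟨h.1.trans h'.1, h.2.trans h'.2⟩

/-- Player `q` can let the time `Δ` elapse in `s`. -/
def CanWait (q : Player) (s : G.State) (Δ : ℝ≥0) : Prop :=
  (∀ δ ≤ Δ, (G.inv s.loc).Sat (s.val.delay δ)) ∧
    ∀ δ, 0 < δ → δ < Δ → ¬ (G.noWait q s.loc).Sat (s.val.delay δ)

end State

/-- The action `a` of player `q`, executed at once in location `l` with clock values `v`, can lead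
to `s'`. -/
def Fire (q : Player) (l : Q) (v : ClockVal X) (a : Option (A q)) (s' : G.State) : Prop :=
  ∃ g R, G.ExtEdge l q a g R s'.loc ∧ g.Sat v ∧ s'.val = v.reset R

theorem State.step_iff {q : Player} {s s' : G.State} {Δ : ℝ≥0} {a : Option (A q)} :
    s.Step q Δ a s' ↔ s.CanWait q Δ ∧ G.Fire q s.loc (s.val.delay Δ) a s' :=
  and_assoc.symm

theorem Fire.z_eq {q : Player} {l : Q} {v : ClockVal X} {a : Option (A q)} {s' : G.State}
    (h : G.Fire q l v a s') : s'.val.z = v.z := by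
  obtain ⟨g, R, -, -, e⟩ := h
  rw [e, ClockVal.z_reset]

theorem State.Step.z_eq {q : Player} {s s' : G.State} {Δ : ℝ≥0} {a : Option (A q)}
    (h : s.Step q Δ a s') : s'.val.z = s.val.z + Δ :=
  (step_iff.1 h).2.z_eq

theorem fire_none_iff {q : Player} {l : Q} {v : ClockVal X} {s' : G.State} :
    G.Fire q l v none s' ↔ s'.loc = l ∧ s'.val = v := by
  constructor
  · rintro ⟨g, R, h, -, e⟩
    generalize hl : s'.loc = l' at h
    cases h
    exact ⟨rfl, by simpa using e⟩
  · rintro ⟨rfl, rfl⟩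
    exact ⟨.tt, ∅, .wait _ _, trivial, by simp⟩

theorem ExtEdge.sat_iff [Finite Q] [Finite X] {q : Player} {l l' : Q} {a : Option (A q)}
    {g : Guard X} {R : Set X} (h : G.ExtEdge l q a g R l') {v w : ClockVal X}
    (hvw : G.ClockEquiv v w) : g.Sat v ↔ g.Sat w := by
  cases h with
  | regular e he => exact hvw.sat_iff (.inl ⟨e, he, rfl⟩)
  | wait => rfl

/-- Actions are compatible with regions. The last clause says that the successor `t'` does not arise
by more actions than `s'` does. -/
theorem Fire.transfer [Finite Q] [Finite X] {q : Player} {l : Q} {v w : ClockVal X}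
    {a : Option (A q)} {s' : G.State} (h : G.Fire q l v a s') (hvw : G.ClockEquiv v w) :
    ∃ t' : G.State, G.Fire q l w a t' ∧ s'.RegionEquiv t' ∧
      ∀ (r : Player) (b : Option (A r)), G.Fire r l w b t' → G.Fire r l v b s' := by
  obtain ⟨g, R, he, hg, e⟩ := h
  have hR := hvw.reset R
  refine ⟨⟨s'.loc, w.reset R, (hR.inv_iff _).1 (e ▸ s'.inv_sat)⟩,
    ⟨g, R, he, (he.sat_iff hvw).1 hg, rfl⟩, ⟨rfl, by
      change G.ClockEquiv s'.val (w.reset R); rwa [e]⟩, ?_⟩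
  rintro r b ⟨g', R', he', hg', e'⟩
  exact ⟨g', R', he', (he'.sat_iff hvw).2 hg', e.trans (hvw.symm.reset_eq_reset e')⟩

namespace State

variable {q : Player} {s t : G.State} {φ : ℝ≥0 ≃o ℝ≥0} {o Δ Δ' : ℝ≥0}

theorem CanWait.mono (h : s.CanWait q Δ) (hle : Δ' ≤ Δ) : s.CanWait q Δ' :=
  ⟨fun δ hδ => h.1 δ (hδ.trans hle), fun δ h0 hδ => h.2 δ h0 (hδ.trans_le hle)⟩

theorem canWait_zero (q : Player) (s : G.State) : s.CanWait q 0 :=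
  ⟨fun δ hδ => by rw [nonpos_iff_eq_zero.1 hδ, ClockVal.delay_zero]; exact s.inv_sat,
    fun δ _ hδ => absurd hδ not_lt_zero⟩

/-- A state that is equivalent to `t` after the delay `o` can wait for what remains of the delay. -/
theorem CanWait.of_shift [Finite Q] [Finite X] (hl : s.loc = t.loc)
    (hφ : G.IsDelayMatch s.val (t.val.delay o) φ) (h : t.CanWait q (o + φ Δ)) :
    s.CanWait q Δ := by
  refine ⟨fun δ hδ => ?_, fun δ h0 hδ => ?_⟩
  · rw [hl, (hφ.clockEquiv δ).inv_iff, ClockVal.delay_delay]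
    exact h.1 _ (by gcongr)
  · rw [hl, (hφ.clockEquiv δ).noWait_iff, ClockVal.delay_delay]
    have h1 := φ.strictMono h0
    have h2 := φ.strictMono hδ
    exact h.2 _ (add_pos_of_nonneg_of_pos zero_le (lt_of_le_of_lt zero_le h1)) (by gcongr)

/-- If `t` can wait for `o`, and then look like `s` and wait further, then it can wait for the
whole time. -/
theorem CanWait.append [Finite Q] [Finite X] (hl : s.loc = t.loc) (ho : t.CanWait q o)
    (ho' : 0 < o → ¬ (G.noWait q t.loc).Sat (t.val.delay o))
    (hφ : G.IsDelayMatch s.val (t.val.delay o) φ) (h : s.CanWait q Δ) :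
    t.CanWait q (o + φ Δ) := by
  have key : ∀ δ, o ≤ δ → t.val.delay δ = (t.val.delay o).delay (φ (φ.symm (δ - o))) := by
    intro δ hδ
    rw [φ.apply_symm_apply, ClockVal.delay_delay, add_tsub_cancel_of_le hδ]
  refine ⟨fun δ hδ => ?_, fun δ h0 hδ => ?_⟩
  · rcases le_total δ o with h1 | h1
    · exact ho.1 δ h1
    · rw [key δ h1, ← hl, ← (hφ.clockEquiv _).inv_iff]
      refine h.1 _ ?_
      rw [φ.symm_apply_le]
      exact tsub_le_iff_left.2 hδ
  · rcases lt_trichotomy δ o with h1 | rfl | h1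
    · exact ho.2 δ h0 h1
    · exact ho' h0
    · rw [key δ h1.le, ← hl, ← (hφ.clockEquiv _).noWait_iff]
      refine h.2 _ ?_ ?_
      · rw [φ.lt_symm_apply]
        have h0 : φ 0 = 0 := φ.map_bot
        rw [h0]
        exact tsub_pos_of_lt h1
      · rw [φ.symm_apply_lt]
        exact (tsub_lt_iff_left h1.le).2 hδ

theorem CanWait.transfer [Finite Q] [Finite X] (hl : s.loc = t.loc)
    (hφ : G.IsDelayMatch s.val t.val φ) (h : s.CanWait q Δ) : t.CanWait q (φ Δ) := by
  simpa using CanWait.append hl (canWait_zero q t) (fun h => absurd h (lt_irrefl _))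
    (by simpa using hφ) h

theorem Step.transfer [Finite Q] [Finite X] {s' : G.State} {a : Option (A q)}
    (hl : s.loc = t.loc) (hφ : G.IsDelayMatch s.val t.val φ) (h : s.Step q Δ a s') :
    ∃ t' : G.State, t.Step q (φ Δ) a t' ∧ s'.RegionEquiv t' := by
  obtain ⟨hw, hf⟩ := step_iff.1 h
  obtain ⟨t', ht', he, -⟩ := hf.transfer (hφ.clockEquiv Δ)
  exact ⟨t', step_iff.2 ⟨hw.transfer hl hφ, hl ▸ ht'⟩, he⟩

theorem step_zero_iff {a : Option (A q)} {s' : G.State} :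
    s.Step q 0 a s' ↔ G.Fire q s.loc s.val a s' := by
  rw [step_iff, ClockVal.delay_zero, and_iff_right (canWait_zero q s)]

/-- The state that is reached by waiting. -/
def wait (s : G.State) (Δ : ℝ≥0) (h : s.CanWait q Δ) : G.State :=
  ⟨s.loc, s.val.delay Δ, h.1 Δ le_rfl⟩

theorem CanWait.step_none (h : s.CanWait q Δ) : s.Step q Δ none (s.wait Δ h) :=
  step_iff.2 ⟨h, fire_none_iff.2 ⟨rfl, rfl⟩⟩

theorem RegionEquiv.playing [Finite Q] [Finite X] (h : s.RegionEquiv t) (hs : s.Playing q) :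
    t.Playing q := by
  obtain ⟨φ, hφ⟩ := h.2.exists_isDelayMatch
  obtain ⟨Δ, a, s', hs'⟩ := hs
  obtain ⟨t', ht', -⟩ := hs'.transfer h.1 hφ
  exact ⟨φ Δ, a, t', ht'⟩

theorem RegionEquiv.playing_iff [Finite Q] [Finite X] (h : s.RegionEquiv t) :
    s.Playing q ↔ t.Playing q :=
  ⟨h.playing, h.symm.playing⟩

end State

/-! ### The transition relation from the point of view of a player -/

section tran

variable {p : Player} {s s' : G.State} {m : ∀ p, TimedMove (A p)} {Δ Δ' : ℝ≥0}
  {a : Option (A p)} {b : Option (A p.opp)}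

theorem RefinedTran.of_both (hm : m p = .propose Δ a) (hm' : m p.opp = .propose Δ' b)
    (hp : s.Playing p) (hp' : s.Playing p.opp) (hs : ∃ t, s.Step p Δ a t)
    (hs' : ∃ t, s.Step p.opp Δ' b t)
    (h : Δ ≤ Δ' ∧ s.Step p Δ a s' ∨ Δ' ≤ Δ ∧ s.Step p.opp Δ' b s') : G.RefinedTran s m s' := by
  obtain ⟨D, rfl, rfl⟩ := Player.exists_joint (B := fun _ => ℝ≥0) p Δ Δ'
  obtain ⟨c, rfl, rfl⟩ := Player.exists_joint (B := fun q => Option (A q)) p a b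
  have h1 := (Player.forall_iff (P := fun q => m q = .propose (D q) (c q)) p).2 ⟨hm, hm'⟩
  have h2 := (Player.forall_iff (P := s.Playing) p).2 ⟨hp, hp'⟩
  have h3 := (Player.forall_iff (P := fun q => ∃ t, s.Step q (D q) (c q) t) p).2 ⟨hs, hs'⟩
  rcases h with ⟨hle, h⟩ | ⟨hle, h⟩
  · exact .both s s' m D c h1 h2 h3 p hle h
  · exact .both s s' m D c h1 h2 h3 p.opp (by simpa using hle) h

theorem RefinedTran.of_alone (hm : m p = .propose Δ a) (hm' : m p.opp = .silent)
    (hp' : ¬ s.Playing p.opp) (hs : s.Step p Δ a s') : G.RefinedTran s m s' :=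
  .alone s s' m p Δ a hm hm' hp' hs

theorem RefinedTran.of_alone_opp (hm : m p.opp = .propose Δ' b) (hm' : m p = .silent)
    (hp' : ¬ s.Playing p) (hs : s.Step p.opp Δ' b s') : G.RefinedTran s m s' :=
  .alone s s' m p.opp Δ' b hm (by cases p <;> exact hm') (by simpa using hp') hs

theorem RefinedTran.elim (h : G.RefinedTran s m s') (p : Player) :
    (∃ Δ a Δ' b, m p = .propose Δ a ∧ m p.opp = .propose Δ' b ∧ s.Playing p ∧ s.Playing p.opp ∧
      (∃ t, s.Step p Δ a t) ∧ (∃ t, s.Step p.opp Δ' b t) ∧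
      (Δ ≤ Δ' ∧ s.Step p Δ a s' ∨ Δ' ≤ Δ ∧ s.Step p.opp Δ' b s')) ∨
    (∃ Δ a, m p = .propose Δ a ∧ m p.opp = .silent ∧ ¬ s.Playing p.opp ∧ s.Step p Δ a s') ∨
    (∃ Δ' b, m p = .silent ∧ m p.opp = .propose Δ' b ∧ ¬ s.Playing p ∧
      s.Step p.opp Δ' b s') := by
  cases h with
  | both _ _ Δ a hm hplay hstep j hj hs' =>
    refine .inl ⟨Δ p, a p, Δ p.opp, a p.opp, hm _, hm _, hplay _, hplay _, hstep _, hstep _, ?_⟩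
    exact (Player.forall_iff (P := fun j => Δ j ≤ Δ j.opp → s.Step j (Δ j) (a j) s' →
      (Δ p ≤ Δ p.opp ∧ s.Step p (Δ p) (a p) s' ∨
        Δ p.opp ≤ Δ p ∧ s.Step p.opp (Δ p.opp) (a p.opp) s')) p).2
      ⟨fun h h' => .inl ⟨h, h'⟩, fun h h' => .inr ⟨by simpa using h, h'⟩⟩ j hj hs'
  | alone _ _ j Δ a hj hopp hplay hs' =>
    refine .inr ?_
    revert Δ a
    refine (Player.forall_iff (P := fun j => m j.opp = .silent → ¬ s.Playing j.opp →
      ∀ Δ a, m j = .propose Δ a → s.Step j Δ a s' → _) p).2 ⟨?_, ?_⟩ j hopp hplay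
    · exact fun h1 h2 Δ a h3 h4 => .inl ⟨Δ, a, h3, h1, h2, h4⟩
    · exact fun h1 h2 Δ a h3 h4 => .inr ⟨Δ, a, by cases p <;> exact h1, h3, by simpa using h2, h4⟩

theorem DeadlockFree.playing (hG : G.DeadlockFree) (h : ¬ s.Playing p) : s.Playing p.opp := by
  obtain ⟨q, hq⟩ := hG s
  have := (Player.forall_iff (P := fun q => s.Playing q → s.Playing p.opp) p).2
    ⟨fun h' => absurd h' h, id⟩
  exact this q hq

theorem DeadlockFree.playing' (hG : G.DeadlockFree) (h : ¬ s.Playing p.opp) : s.Playing p := by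
  simpa using hG.playing h

/-- A player has to propose an executable move if they can play, and to be silent otherwise. -/
theorem mem_moves_iff (hG : G.DeadlockFree) {x : TimedMove (A p)} :
    x ∈ G.refinedTS.moves p s ↔
      (s.Playing p ∧ ∃ Δ a t, x = .propose Δ a ∧ s.Step p Δ a t) ∨
        (¬ s.Playing p ∧ x = .silent) := by
  constructor
  · rintro ⟨m, s', rfl, h⟩
    rcases RefinedTran.elim h p with ⟨Δ, a, Δ', b, h1, -, h3, -, ⟨t, ht⟩, -⟩ |
      ⟨Δ, a, h1, -, h3, h4⟩ | ⟨Δ', b, h1, -, h3, -⟩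
    · exact .inl ⟨h3, Δ, a, t, h1, ht⟩
    · exact .inl ⟨hG.playing' h3, Δ, a, s', h1, h4⟩
    · exact .inr ⟨h3, h1⟩
  · rintro (⟨hp, Δ, a, t, rfl, ht⟩ | ⟨hp, rfl⟩)
    · by_cases hp' : s.Playing p.opp
      · obtain ⟨m, hm, hm'⟩ := Player.exists_joint (B := fun q => TimedMove (A q)) p
          (.propose Δ a) (.propose 0 none)
        have h0 := (State.canWait_zero p.opp s).step_none
        exact ⟨m, _, hm, RefinedTran.of_both hm hm' hp hp' ⟨t, ht⟩ ⟨_, h0⟩ (.inr ⟨zero_le, h0⟩)⟩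
      · obtain ⟨m, hm, hm'⟩ := Player.exists_joint (B := fun q => TimedMove (A q)) p
          (.propose Δ a) .silent
        exact ⟨m, _, hm, RefinedTran.of_alone hm hm' hp' ht⟩
    · obtain ⟨m, hm, hm'⟩ := Player.exists_joint (B := fun q => TimedMove (A q)) p
        .silent (.propose 0 none)
      exact ⟨m, _, hm, RefinedTran.of_alone_opp hm' hm hp
        (State.canWait_zero p.opp s).step_none⟩

end tran

/-! ### Blame -/

/-- The side of the question `b` that is to the disadvantage of `p`, where `b` says that the
Controller is blamed for a step. -/
def Adverse : Player → Prop → Prop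
  | .controller, b => b
  | .environment, b => ¬ b

/-- The step stays in the location and leaves the region, so that nobody is blamed. -/
def Unblamed (s s' : G.State) : Prop := s'.loc = s.loc ∧ ¬ G.ClockEquiv s.val s'.val

theorem lazyBlame_controller_iff {s s' : G.State} {m : ∀ p, TimedMove (A p)} :
    G.lazyBlame s m s' = some .controller ↔
      ¬ Unblamed s s' ∧ s.MoveStep .controller (m .controller) s' := by
  unfold lazyBlame blame Unblamed
  split_ifs with h1 h2 <;> simp_all

theorem adverse_lazyBlame_of_imp {p : Player} {s s' t t' : G.State} {m n : ∀ p, TimedMove (A p)}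
    (h : ¬ Unblamed s s' → s.MoveStep p (m p) s' → ¬ Unblamed t t' ∧ t.MoveStep p (n p) t')
    (h' : ¬ Unblamed t t' → t.MoveStep p.opp (n p.opp) t' →
      ¬ Unblamed s s' ∧ s.MoveStep p.opp (m p.opp) s') :
    Adverse p (G.lazyBlame s m s' = some .controller) →
      Adverse p (G.lazyBlame t n t' = some .controller) := by
  cases p
  · simp only [Adverse, lazyBlame_controller_iff]
    exact fun ⟨h1, h2⟩ => h h1 h2
  · simp only [Adverse, lazyBlame_controller_iff]
    exact mt fun ⟨h1, h2⟩ => h' h1 h2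

/-! ### Shadow positions -/

variable (G) in
/-- The position of a shadow: a history of the given strategy, and the time `off` that has elapsed
since its last state. A positive `off` is only used while the opponent cannot play, when nothing can
interrupt the last proposal of the strategy. -/
structure Shadow where
  hist : History G.State fun p => TimedMove (A p)
  off : ℝ≥0

namespace Shadow

/-- The clock values in the position. -/
def val (c : G.Shadow) : ClockVal X := c.hist.last.val.delay c.off

/-- The state `s` is equivalent to the current state of the shadow. -/
def At (c : G.Shadow) (s : G.State) : Prop :=
  s.loc = c.hist.last.loc ∧ G.ClockEquiv s.val c.val

/-- No further regions and no ticks lie between the position and the end of the delay `Δ`. -/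
def Arrived (c : G.Shadow) (Δ : ℝ≥0) : Prop :=
  G.ClockEquiv c.val (c.hist.last.val.delay Δ) ∧ ⌊c.val.z⌋₊ = ⌊c.hist.last.val.z + Δ⌋₊

/-- The action that the shadow strategy proposes with delay `Δ` may be executed at once: the rest of
the delay stays in the region, and the opponent could wait as long. -/
def Immediate (p : Player) (c : G.Shadow) (Δ : ℝ≥0) : Prop :=
  c.Arrived Δ ∧ (c.hist.last.Playing p.opp → ∀ δ, 0 < δ → δ < Δ →
    ¬ (G.noWait p.opp c.hist.last.loc).Sat (c.hist.last.val.delay δ))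

/-- The next stop on the way to the end of the delay `Δ`: the end itself, or the moment when `z`
reaches its next integer value. -/
noncomputable def target (c : G.Shadow) (Δ : ℝ≥0) : ℝ≥0 :=
  min Δ (c.off + (⌊c.val.z⌋₊ + 1 - c.val.z))

/-- The position moves on to the next stop. -/
noncomputable def advance (c : G.Shadow) (Δ : ℝ≥0) : G.Shadow := ⟨c.hist, c.target Δ⟩

variable {c : G.Shadow} {s t : G.State} {Δ : ℝ≥0} {p : Player}

theorem val_z (c : G.Shadow) : c.val.z = c.hist.last.val.z + c.off := rfl

theorem val_of_off_eq_zero (h : c.off = 0) : c.val = c.hist.last.val := by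
  rw [val, h, ClockVal.delay_zero]

theorem At.regionEquiv (h : c.At s) (h0 : c.off = 0) : s.RegionEquiv c.hist.last :=
  ⟨h.1, val_of_off_eq_zero h0 ▸ h.2⟩

theorem At.congr [Finite X] (h : c.At s) (hst : s.RegionEquiv t) : c.At t :=
  ⟨hst.1.symm.trans h.1, hst.2.symm.trans h.2⟩

theorem At.equiv [Finite X] (h : c.At s) (h' : c.At t) : s.RegionEquiv t :=
  ⟨h.1.trans h'.1.symm, h.2.trans h'.2.symm⟩

theorem arrived_self (c : G.Shadow) : c.Arrived c.off := ⟨.refl _, rfl⟩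

theorem target_le (c : G.Shadow) (Δ : ℝ≥0) : c.target Δ ≤ Δ := min_le_left _ _

theorem lt_target (h : c.off < Δ) : c.off < c.target Δ :=
  lt_min h (lt_add_of_pos_right _ (tsub_pos_of_lt (Nat.lt_floor_add_one _)))

theorem off_add_sub (c : G.Shadow) :
    c.hist.last.val.z + (c.off + (⌊c.val.z⌋₊ + 1 - c.val.z)) = ⌊c.val.z⌋₊ + 1 := by
  rw [← add_assoc, ← val_z, add_tsub_cancel_of_le (Nat.lt_floor_add_one _).le]

theorem target_z_le (c : G.Shadow) (Δ : ℝ≥0) :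
    c.hist.last.val.z + c.target Δ ≤ ⌊c.val.z⌋₊ + 1 := by
  rw [← c.off_add_sub]
  gcongr
  exact min_le_right _ _

theorem target_eq_or (c : G.Shadow) (Δ : ℝ≥0) :
    c.target Δ = Δ ∨ c.target Δ < Δ ∧ c.hist.last.val.z + c.target Δ = ⌊c.val.z⌋₊ + 1 := by
  rcases (c.target_le Δ).eq_or_lt with h | h
  · exact .inl h
  · refine .inr ⟨h, ?_⟩
    rw [← c.off_add_sub]
    congr 1
    exact (min_eq_right (not_lt.1 fun h' => h.ne (min_eq_left h'.le)))

variable {σ : G.refinedTS.Strategy p}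

/-- The positions that the shadow of a play may take. If the position has come to the end of a
proposed delay without having executed the action, then the action does not lead back to the present
region. Executing it therefore is blamed only if it changes the location. -/
structure Legit (σ : G.refinedTS.Strategy p) (c : G.Shadow) : Prop where
  isHistory : G.refinedTS.IsHistory c.hist
  of_pos : 0 < c.off → ¬ c.hist.last.Playing p.opp ∧ ∃ Δ a, σ.choose c.hist = .propose Δ a ∧
    c.off ≤ Δ ∧ (c.Arrived Δ → ∀ t, c.hist.last.Step p Δ a t → ¬ c.At t)

namespace Legit

variable {a : Option (A p)}

theorem off_eq_zero (hc : c.Legit σ) (h : c.hist.last.Playing p.opp) : c.off = 0 :=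
  nonpos_iff_eq_zero.1 (not_lt.1 fun h' => (hc.of_pos h').1 h)

theorem off_le (hc : c.Legit σ) (h : σ.choose c.hist = .propose Δ a) : c.off ≤ Δ := by
  rcases (zero_le (a := c.off)).eq_or_lt with h0 | h0
  · exact h0 ▸ zero_le
  · obtain ⟨-, Δ', a', h', hle, -⟩ := hc.of_pos h0
    rw [h] at h'
    cases h'
    exact hle

theorem not_at (hc : c.Legit σ) (h : σ.choose c.hist = .propose Δ a) (h0 : 0 < c.off)
    (harr : c.Arrived Δ) (ht : c.hist.last.Step p Δ a t) : ¬ c.At t := by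
  obtain ⟨-, Δ', a', h', -, hn⟩ := hc.of_pos h0
  rw [h] at h'
  cases h'
  exact hn harr t ht

theorem exists_step (hc : c.Legit σ) (hG : G.DeadlockFree) (h : σ.choose c.hist = .propose Δ a) :
    ∃ t, c.hist.last.Step p Δ a t := by
  have := (mem_moves_iff hG).1 (σ.available c.hist hc.isHistory)
  rw [h] at this
  rcases this with ⟨-, Δ', a', t, e, ht⟩ | ⟨-, e⟩
  · cases e; exact ⟨t, ht⟩
  · cases e

theorem choose_eq_silent_iff (hc : c.Legit σ) (hG : G.DeadlockFree) :
    σ.choose c.hist = .silent ↔ ¬ c.hist.last.Playing p := by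
  rcases (mem_moves_iff hG).1 (σ.available c.hist hc.isHistory) with ⟨h, Δ, a, t, e, -⟩ | ⟨h, e⟩
  · simp [h, e]
  · simp [h, e]

theorem exists_choose_eq (hc : c.Legit σ) (hG : G.DeadlockFree) (h : c.hist.last.Playing p) :
    ∃ Δ a, σ.choose c.hist = .propose Δ a := by
  cases e : σ.choose c.hist with
  | silent => exact absurd h ((hc.choose_eq_silent_iff hG).1 e)
  | propose Δ a => exact ⟨Δ, a, rfl⟩

theorem canWait (hc : c.Legit σ) (hG : G.DeadlockFree) (h : σ.choose c.hist = .propose Δ a) :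
    c.hist.last.CanWait p Δ :=
  let ⟨_, ht⟩ := hc.exists_step hG h
  (State.step_iff.1 ht).1

theorem off_lt (hc : c.Legit σ) (h : σ.choose c.hist = .propose Δ a) (hi : ¬ c.Immediate p Δ) :
    c.off < Δ := by
  refine (hc.off_le h).lt_of_ne fun e => hi ⟨e ▸ c.arrived_self, fun hplay δ h0 hδ => ?_⟩
  rw [← e, hc.off_eq_zero hplay] at hδ
  exact absurd hδ not_lt_zero

variable [Finite Q] [Finite X]

/-- An opponent who cannot play in the last state of the shadow history cannot play in the current
position either. -/
theorem not_playing_opp (hc : c.Legit σ) (hG : G.DeadlockFree) (hp : G.PlayingBeforeWait p.opp)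
    (hs : c.At s) (h : ¬ c.hist.last.Playing p.opp) : ¬ s.Playing p.opp := by
  intro hplay
  obtain ⟨Δ, a, e⟩ := hc.exists_choose_eq hG (hG.playing' h)
  have hw := (hc.canWait hG e).mono (hc.off_le e)
  have hs' : s.RegionEquiv (c.hist.last.wait c.off hw) := hs
  exact h (hp _ (c.hist.last.wait c.off hw) c.off rfl rfl hw.1 (hs'.playing hplay))

theorem playing_iff (hc : c.Legit σ) (hG : G.DeadlockFree) (hp : G.PlayingBeforeWait p.opp)
    (hs : c.At s) : s.Playing p ↔ c.hist.last.Playing p := by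
  by_cases h : c.hist.last.Playing p.opp
  · exact (hs.regionEquiv (hc.off_eq_zero h)).playing_iff
  · exact iff_of_true (hG.playing' (hc.not_playing_opp hG hp hs h)) (hG.playing' h)

end Legit

/-! ### The moves that follow a shadow -/

open Classical in
/-- A choice of matching delays after two valuations. -/
noncomputable def matchIso (v w : ClockVal X) : ℝ≥0 ≃o ℝ≥0 :=
  if h : ∃ φ, G.IsDelayMatch v w φ then h.choose else .refl _

theorem isDelayMatch_matchIso [Finite X] {v w : ClockVal X} (h : G.ClockEquiv v w) :
    G.IsDelayMatch v w (matchIso (G := G) v w) := by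
  have h' := h.exists_isDelayMatch
  rw [matchIso, dif_pos h']
  exact h'.choose_spec

/-- The delay after `s` that corresponds to the way of the shadow to its next stop. -/
noncomputable def waitDelay (c : G.Shadow) (Δ : ℝ≥0) (s : G.State) : ℝ≥0 :=
  (matchIso (G := G) s.val c.val).symm (c.target Δ - c.off)

open Classical in
/-- The move in state `s` of the strategy that follows the shadow strategy `σ` in position `c`. It
waits where `σ` does, with a stop whenever `z` reaches an integer value, and executes the action
that `σ` proposes at the end. -/
noncomputable def move (σ : G.refinedTS.Strategy p) (c : G.Shadow) (s : G.State) :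
    TimedMove (A p) :=
  if c.At s ∧ c.Legit σ then
    match σ.choose c.hist with
    | .silent => .silent
    | .propose Δ a => if c.Immediate p Δ then .propose 0 a else .propose (c.waitDelay Δ s) none
  else if s.Playing p then .propose 0 none else .silent

section move

variable {a : Option (A p)}

theorem move_of_silent (hs : c.At s) (hc : c.Legit σ) (h : σ.choose c.hist = .silent) :
    move σ c s = .silent := by
  rw [move, if_pos ⟨hs, hc⟩, h]

theorem move_of_immediate (hs : c.At s) (hc : c.Legit σ) (h : σ.choose c.hist = .propose Δ a)
    (hi : c.Immediate p Δ) : move σ c s = .propose 0 a := by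
  rw [move, if_pos ⟨hs, hc⟩, h]
  exact if_pos hi

theorem move_of_not_immediate (hs : c.At s) (hc : c.Legit σ)
    (h : σ.choose c.hist = .propose Δ a) (hi : ¬ c.Immediate p Δ) :
    move σ c s = .propose (c.waitDelay Δ s) none := by
  rw [move, if_pos ⟨hs, hc⟩, h]
  exact if_neg hi

theorem move_split {a' : Option (A p)} (h : move σ c s = .propose Δ a') :
    (a' ≠ none → Δ = 0) ∧ (0 < Δ → a' = none) := by
  by_cases hc : c.At s ∧ c.Legit σ
  · cases e : σ.choose c.hist with
    | silent => rw [move_of_silent hc.1 hc.2 e] at h; cases h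
    | propose Δ a =>
      by_cases hi : c.Immediate p Δ
      · rw [move_of_immediate hc.1 hc.2 e hi] at h
        cases h
        simp
      · rw [move_of_not_immediate hc.1 hc.2 e hi] at h
        cases h
        simp
  · rw [move, if_neg hc] at h
    split_ifs at h
    cases h
    simp

theorem off_add_waitDelay (h : c.off < Δ) :
    c.off + matchIso (G := G) s.val c.val (c.waitDelay Δ s) = c.target Δ := by
  rw [waitDelay, OrderIso.apply_symm_apply, add_tsub_cancel_of_le (lt_target h).le]

theorem val_delay_waitDelay (h : c.off < Δ) :
    c.val.delay (matchIso (G := G) s.val c.val (c.waitDelay Δ s)) = (c.advance Δ).val := by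
  have e := off_add_waitDelay (s := s) h
  change (c.hist.last.val.delay c.off).delay _ = c.hist.last.val.delay (c.target Δ)
  rw [ClockVal.delay_delay, e]

variable [Finite X]

theorem At.delay_waitDelay (hs : c.At s) (h : c.off < Δ) :
    G.ClockEquiv (s.val.delay (c.waitDelay Δ s)) (c.advance Δ).val :=
  val_delay_waitDelay h ▸ (isDelayMatch_matchIso hs.2).clockEquiv _

theorem At.tick_waitDelay_iff (hs : c.At s) (h : c.off < Δ) :
    ⌊s.val.z⌋₊ < ⌊s.val.z + c.waitDelay Δ s⌋₊ ↔ ⌊c.val.z⌋₊ < ⌊(c.advance Δ).val.z⌋₊ := by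
  rw [(isDelayMatch_matchIso hs.2).tick_iff, ← ClockVal.z_delay c.val, val_delay_waitDelay h]

/-- The waiting moves do not let `z` go beyond its next integer value. -/
theorem At.z_add_waitDelay_le (hs : c.At s) (h : c.off < Δ) :
    s.val.z + c.waitDelay Δ s ≤ ⌊s.val.z⌋₊ + 1 := by
  have hm := isDelayMatch_matchIso hs.2 (c.waitDelay Δ s)
  have h1 := hm.2
  have hz : c.val.z + matchIso (G := G) s.val c.val (c.waitDelay Δ s) =
      c.hist.last.val.z + c.target Δ := by
    rw [← ClockVal.z_delay, val_delay_waitDelay h]; rfl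
  have hle := c.target_z_le Δ
  rw [← hz] at hle
  rcases hle.lt_or_eq with hlt | heq
  · have h2 : ⌊c.val.z + matchIso (G := G) s.val c.val (c.waitDelay Δ s)⌋₊ < ⌊c.val.z⌋₊ + 1 := by
      rw [Nat.floor_lt zero_le]; exact_mod_cast hlt
    have h3 : ⌊s.val.z + c.waitDelay Δ s⌋₊ < ⌊s.val.z⌋₊ + 1 := by omega
    rw [Nat.floor_lt zero_le] at h3
    exact_mod_cast h3.le
  -- `z` reaches an integer value in the shadow, so that it does so after `s`
  · have h2 : ⌊c.val.z + matchIso (G := G) s.val c.val (c.waitDelay Δ s)⌋₊ = ⌊c.val.z⌋₊ + 1 := by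
      rw [heq]; exact_mod_cast Nat.floor_natCast (R := ℝ≥0) (⌊c.val.z⌋₊ + 1)
    have h3 : ⌊s.val.z + c.waitDelay Δ s⌋₊ = ⌊s.val.z⌋₊ + 1 := by omega
    have h4 := (hm.1.2.2 none (by rintro _ ⟨⟩)).2 (by
      change Int.fract ((c.val.z + matchIso (G := G) s.val c.val (c.waitDelay Δ s) : ℝ≥0) : ℝ) = 0
      rw [heq]
      exact_mod_cast Int.fract_natCast (R := ℝ) (⌊c.val.z⌋₊ + 1))
    change Int.fract ((s.val.z + c.waitDelay Δ s : ℝ≥0) : ℝ) = 0 at h4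
    have h5 := Int.floor_add_fract ((s.val.z + c.waitDelay Δ s : ℝ≥0) : ℝ)
    rw [h4, add_zero, ← natCast_floor_coe, h3] at h5
    apply le_of_eq
    apply NNReal.eq
    rw [← h5]; push_cast; rfl

theorem move_z_le {a' : Option (A p)} (h : move σ c s = .propose Δ a') :
    s.val.z + Δ ≤ ⌊s.val.z⌋₊ + 1 := by
  have h0 : s.val.z + 0 ≤ ⌊s.val.z⌋₊ + 1 := by
    rw [add_zero]; exact (Nat.lt_floor_add_one _).le
  by_cases hc : c.At s ∧ c.Legit σ
  · cases e : σ.choose c.hist with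
    | silent => rw [move_of_silent hc.1 hc.2 e] at h; cases h
    | propose Δ a =>
      by_cases hi : c.Immediate p Δ
      · rw [move_of_immediate hc.1 hc.2 e hi] at h
        cases h
        exact h0
      · rw [move_of_not_immediate hc.1 hc.2 e hi] at h
        cases h
        exact hc.1.z_add_waitDelay_le (hc.2.off_lt e hi)
  · rw [move, if_neg hc] at h
    split_ifs at h
    cases h
    exact h0

variable [Finite Q]

theorem At.canWait_waitDelay (hs : c.At s) (hc : c.Legit σ) (hG : G.DeadlockFree)
    (h : σ.choose c.hist = .propose Δ a) (hlt : c.off < Δ) : s.CanWait p (c.waitDelay Δ s) :=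
  State.CanWait.of_shift hs.1 (isDelayMatch_matchIso hs.2)
    ((hc.canWait hG h).mono ((off_add_waitDelay hlt).trans_le (c.target_le Δ)))

theorem move_mem_moves (hG : G.DeadlockFree) (hp : G.PlayingBeforeWait p.opp)
    (σ : G.refinedTS.Strategy p) (c : G.Shadow) (s : G.State) :
    move σ c s ∈ G.refinedTS.moves p s := by
  rw [mem_moves_iff hG]
  by_cases h : c.At s ∧ c.Legit σ
  · obtain ⟨hs, hc⟩ := h
    rw [hc.playing_iff hG hp hs]
    by_cases hpl : c.hist.last.Playing p
    · obtain ⟨Δ, a, e⟩ := hc.exists_choose_eq hG hpl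
      refine .inl ⟨hpl, ?_⟩
      by_cases hi : c.Immediate p Δ
      · obtain ⟨t, ht⟩ := hc.exists_step hG e
        obtain ⟨s', hs', -⟩ := (State.step_iff.1 ht).2.transfer (hs.2.trans hi.1.1).symm
        exact ⟨0, a, s', move_of_immediate hs hc e hi, State.step_zero_iff.2 (hs.1 ▸ hs')⟩
      · exact ⟨_, none, _, move_of_not_immediate hs hc e hi,
          (hs.canWait_waitDelay hc hG e (hc.off_lt e hi)).step_none⟩
    · exact .inr ⟨hpl, move_of_silent hs hc ((hc.choose_eq_silent_iff hG).2 hpl)⟩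
  · rw [move, if_neg h]
    split_ifs with hpl
    · exact .inl ⟨hpl, 0, none, _, rfl, (State.canWait_zero p s).step_none⟩
    · exact .inr ⟨hpl, rfl⟩

/-- Moves that follow the same shadow from equivalent states lead to the same regions. -/
theorem moveStep_move_transfer (hG : G.DeadlockFree)
    (hst : s.RegionEquiv t) {s' : G.State} (h : s.MoveStep p (move σ c s) s') :
    ∃ t', t.MoveStep p (move σ c t) t' ∧ s'.RegionEquiv t' := by
  have zero : ∀ a : Option (A p), s.Step p 0 a s' → ∃ t', t.Step p 0 a t' ∧ s'.RegionEquiv t' := by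
    intro a h
    obtain ⟨φ, hφ⟩ := hst.2.exists_isDelayMatch
    have h0 : φ 0 = 0 := φ.map_bot
    obtain ⟨t', ht'⟩ := h.transfer hst.1 hφ
    exact ⟨t', h0 ▸ ht'⟩
  by_cases hc : c.At s ∧ c.Legit σ
  · obtain ⟨hs, hc⟩ := hc
    have ht := hs.congr hst
    cases e : σ.choose c.hist with
    | silent => rw [move_of_silent hs hc e] at h; exact h.elim
    | propose Δ a =>
      by_cases hi : c.Immediate p Δ
      · rw [move_of_immediate hs hc e hi] at h
        rw [move_of_immediate ht hc e hi]
        exact zero a h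
      · rw [move_of_not_immediate hs hc e hi] at h
        rw [move_of_not_immediate ht hc e hi]
        have hlt := hc.off_lt e hi
        have hf := fire_none_iff.1 (State.step_iff.1 h).2
        refine ⟨_, (ht.canWait_waitDelay hc hG e hlt).step_none, ?_, ?_⟩
        · exact hf.1.trans hst.1
        · rw [hf.2]
          exact (hs.delay_waitDelay hlt).trans (ht.delay_waitDelay hlt).symm
  · have hc' : ¬ (c.At t ∧ c.Legit σ) := fun h => hc ⟨h.1.congr hst.symm, h.2⟩
    rw [move, if_neg hc] at h
    rw [move, if_neg hc']
    rw [← hst.playing_iff]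
    split_ifs at h ⊢
    · exact zero none h
    · exact h.elim

end move

end Shadow

/-! ### The simulation step -/

/-- The states that are equivalent to `s`. -/
def State.region (s : G.State) : Set G.State := {t | s.RegionEquiv t}

namespace Shadow

variable {c : G.Shadow} {s s' t : G.State} {Δ Δ' : ℝ≥0} {p : Player} {σ : G.refinedTS.Strategy p}
  {a : Option (A p)} {m n : ∀ p, TimedMove (A p)}

/-- The positions to which the shadow `c` can move when the play enters the region `r`, with or
without a tick: either the shadow history is extended by a step that follows `σ`, or the shadow
waits while nothing can interrupt the last proposal of `σ`. -/
inductive Succ (σ : G.refinedTS.Strategy p) (c : G.Shadow) (tick : Prop) (r : Set G.State) :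
    G.Shadow → Prop
  | snoc (m : ∀ p, TimedMove (A p)) (t : G.State) (htran : G.RefinedTran c.hist.last m t)
      (hm : m p = σ.choose c.hist) (hr : ∀ s ∈ r, s.RegionEquiv t)
      (htick : tick ↔ ⌊c.val.z⌋₊ < ⌊t.val.z⌋₊) : Succ σ c tick r ⟨c.hist.snoc m t, 0⟩
  | stutter (Δ : ℝ≥0) (a : Option (A p)) (hσ : σ.choose c.hist = .propose Δ a)
      (hopp : ¬ c.hist.last.Playing p.opp) (harr : ¬ c.Arrived Δ)
      (hfin : (c.advance Δ).Arrived Δ → ∀ t, c.hist.last.Step p Δ a t → ¬ (c.advance Δ).At t)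
      (hr : ∀ s ∈ r, (c.advance Δ).At s)
      (htick : tick ↔ ⌊c.val.z⌋₊ < ⌊(c.advance Δ).val.z⌋₊) : Succ σ c tick r (c.advance Δ)

/-- The shadow moves from `c` to `c'` by a step that is blamed on the Controller. -/
def BlamedTo (c c' : G.Shadow) : Prop :=
  ∃ m t, c'.hist = c.hist.snoc m t ∧ G.lazyBlame c.hist.last m t = some .controller

theorem Succ.legit {tick : Prop} {r : Set G.State} {c' : G.Shadow} (h : Succ σ c tick r c')
    (hc : c.Legit σ) : c'.Legit σ := by
  cases h with
  | snoc m t htran hm hr htick => exact ⟨⟨hc.isHistory, htran⟩, fun h => absurd h (lt_irrefl _)⟩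
  | stutter Δ a hσ hopp harr hfin hr htick =>
    exact ⟨hc.isHistory, fun _ => ⟨hopp, Δ, a, hσ, c.target_le Δ, hfin⟩⟩

theorem Succ.at {tick : Prop} {c' : G.Shadow} (h : Succ σ c tick s.region c') : c'.At s := by
  cases h with
  | snoc m t htran hm hr htick =>
    have := hr s (.refl s)
    exact ⟨this.1, by simpa [val, History.last] using this.2⟩
  | stutter Δ a hσ hopp harr hfin hr htick => exact hr s (.refl s)

theorem Succ.tick_iff {tick : Prop} {r : Set G.State} {c' : G.Shadow} (h : Succ σ c tick r c') :
    tick ↔ ⌊c.val.z⌋₊ < ⌊c'.val.z⌋₊ := by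
  cases h with
  | snoc m t htran hm hr htick => simpa [val, History.last] using htick
  | stutter Δ a hσ hopp harr hfin hr htick => exact htick

theorem _root_.History.ne_snoc {S : Type*} {M : Player → Type*} (h : History S M) (m : ∀ p, M p)
    (s : S) : h ≠ h.snoc m s := fun e => by
  have := congrArg sizeOf e
  simp at this

theorem blamedTo_snoc_iff {o : ℝ≥0} :
    c.BlamedTo ⟨c.hist.snoc m t, o⟩ ↔ G.lazyBlame c.hist.last m t = some .controller := by
  constructor
  · rintro ⟨m', t', e, h⟩
    cases e
    exact h
  · exact fun h => ⟨m, t, rfl, h⟩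

theorem not_blamedTo_advance : ¬ c.BlamedTo (c.advance Δ) := by
  rintro ⟨m, t, e, -⟩
  exact c.hist.ne_snoc m t e

/-- The shadow `c` can follow the step from `s` to `s'` so that `p` does not fare worse in the play
than in the shadow. -/
def Simulates (σ : G.refinedTS.Strategy p) (c : G.Shadow) (s : G.State)
    (m : ∀ p, TimedMove (A p)) (s' : G.State) : Prop :=
  ∃ c', Succ σ c (⌊s.val.z⌋₊ < ⌊s'.val.z⌋₊) s'.region c' ∧
    (¬ ⌊s.val.z⌋₊ < ⌊s'.val.z⌋₊ → Adverse p (G.lazyBlame s m s' = some .controller) →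
      Adverse p (c.BlamedTo c'))

theorem Simulates.of_snoc [Finite X] (htran : G.RefinedTran c.hist.last n t)
    (hn : n p = σ.choose c.hist) (ht : s'.RegionEquiv t)
    (htick : ⌊s.val.z⌋₊ < ⌊s'.val.z⌋₊ ↔ ⌊c.val.z⌋₊ < ⌊t.val.z⌋₊)
    (h : ¬ ⌊s.val.z⌋₊ < ⌊s'.val.z⌋₊ → ¬ Unblamed s s' → s.MoveStep p (m p) s' →
      ¬ Unblamed c.hist.last t ∧ c.hist.last.MoveStep p (n p) t)
    (h' : ¬ ⌊s.val.z⌋₊ < ⌊s'.val.z⌋₊ → ¬ Unblamed c.hist.last t →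
      c.hist.last.MoveStep p.opp (n p.opp) t →
      ¬ Unblamed s s' ∧ s.MoveStep p.opp (m p.opp) s') : Simulates σ c s m s' := by
  refine ⟨_, .snoc n t htran hn (fun u hu => (State.RegionEquiv.symm hu).trans ht) htick,
    fun hnt => ?_⟩
  rw [blamedTo_snoc_iff]
  exact adverse_lazyBlame_of_imp (h hnt) (h' hnt)

theorem _root_.TimedArena.unblamed_iff [Finite X] {t' : G.State} (h : s.RegionEquiv t)
    (h' : s'.RegionEquiv t') : Unblamed s s' ↔ Unblamed t t' := by
  unfold Unblamed
  rw [h.1, h'.1]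
  exact and_congr_right fun _ => not_congr
    ⟨fun e => (h.2.symm.trans e).trans h'.2, fun e => (h.2.trans e).trans h'.2.symm⟩

variable [Finite X]

/-- A completed waiting move without a tick leaves the region if the shadow has not yet arrived. -/
theorem unblamed_of_wait (hs : c.At s) (hlt : c.off < Δ) (harr : ¬ c.Arrived Δ)
    (hloc : s'.loc = s.loc) (hval : s'.val = s.val.delay (c.waitDelay Δ s))
    (hnt : ¬ ⌊s.val.z⌋₊ < ⌊s'.val.z⌋₊) : c.target Δ = Δ ∧ Unblamed s s' := by
  rw [hval, ClockVal.z_delay, hs.tick_waitDelay_iff hlt] at hnt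
  have hz : (c.advance Δ).val.z = c.hist.last.val.z + c.target Δ := rfl
  rw [hz] at hnt
  have ht : c.target Δ = Δ := by
    rcases c.target_eq_or Δ with h | ⟨-, h⟩
    · exact h
    · refine absurd ?_ hnt
      rw [h]
      have := Nat.floor_natCast (R := ℝ≥0) (⌊c.val.z⌋₊ + 1)
      push_cast at this
      omega
  refine ⟨ht, hloc, fun he => harr ⟨?_, ?_⟩⟩
  · have := hs.delay_waitDelay hlt
    rw [← hval] at this
    have := (hs.2.symm.trans he).trans this
    rwa [advance, ht] at this
  · rw [ht] at hnt
    refine le_antisymm (Nat.floor_mono ?_) (not_lt.1 hnt)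
    rw [val_z]
    gcongr

variable [Finite Q]

theorem simulates_alone (hG : G.DeadlockFree) (hp : G.PlayingBeforeWait p.opp) (hc : c.Legit σ)
    (hs : c.At s) (htran : G.RefinedTran s m s') (hm : m p = move σ c s)
    (hopp : ¬ c.hist.last.Playing p.opp) : Simulates σ c s m s' := by
  have hopp' := hc.not_playing_opp hG hp hs hopp
  rcases htran.elim p with ⟨_, _, _, _, -, -, -, h, -⟩ | ⟨δ, a', h1, h2, -, h4⟩ | ⟨_, _, -, -, h, -⟩
  · exact absurd h hopp'
  rotate_left
  · exact absurd (hG.playing' hopp') h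
  obtain ⟨Δ, a, e⟩ := hc.exists_choose_eq hG (hG.playing' hopp)
  have hw := hc.canWait hG e
  obtain ⟨n, hn, hn'⟩ := Player.exists_joint (B := fun q => TimedMove (A q)) p
    (.propose Δ a) .silent
  have snoc : ∀ t, c.hist.last.Step p Δ a t → s'.RegionEquiv t →
      (⌊s.val.z⌋₊ < ⌊s'.val.z⌋₊ ↔ ⌊c.val.z⌋₊ < ⌊t.val.z⌋₊) →
      (¬ ⌊s.val.z⌋₊ < ⌊s'.val.z⌋₊ → ¬ Unblamed s s' → ¬ Unblamed c.hist.last t) →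
      Simulates σ c s m s' := by
    intro t ht het htick hub
    refine .of_snoc (.of_alone hn hn' hopp ht) (hn.trans e.symm) het htick
      (fun hnt h _ => ⟨hub hnt h, by rw [hn]; exact ht⟩) fun _ _ h => ?_
    rw [hn'] at h
    exact h.elim
  by_cases hi : c.Immediate p Δ
  · rw [move_of_immediate hs hc e hi] at hm
    rw [hm] at h1
    cases h1
    obtain ⟨t, ht, het, -⟩ := (State.step_zero_iff.1 h4).transfer (hs.2.trans hi.1.1)
    have hst : c.hist.last.Step p Δ _ t := State.step_iff.2 ⟨hw, hs.1 ▸ ht⟩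
    have hz : ⌊s.val.z⌋₊ < ⌊s'.val.z⌋₊ ↔ ⌊c.val.z⌋₊ < ⌊t.val.z⌋₊ := by
      rw [h4.z_eq, hst.z_eq, add_zero, hi.1.2]
      exact iff_of_false (lt_irrefl _) (lt_irrefl _)
    refine snoc t hst het hz fun _ hub hub' => ?_
    rcases (zero_le (a := c.off)).eq_or_lt with h0 | h0
    · exact hub ((unblamed_iff (hs.regionEquiv h0.symm) het).2 hub')
    · refine hub ⟨het.1.trans (hub'.1.trans hs.1.symm), fun hss' => ?_⟩
      exact hc.not_at e h0 hi.1 hst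
        ⟨hub'.1, (het.2.symm.trans hss'.symm).trans hs.2⟩
  · have hlt := hc.off_lt e hi
    have harr : ¬ c.Arrived Δ := fun h => hi ⟨h, fun h => absurd h hopp⟩
    rw [move_of_not_immediate hs hc e hi] at hm
    rw [hm] at h1
    cases h1
    obtain ⟨hloc, hval⟩ := fire_none_iff.1 (State.step_iff.1 h4).2
    have hub := unblamed_of_wait hs hlt harr hloc hval
    have hs' : (c.advance Δ).At s' := ⟨hloc.trans hs.1, hval ▸ hs.delay_waitDelay hlt⟩
    have htick := hs.tick_waitDelay_iff hlt
    rw [← ClockVal.z_delay, ← hval] at htick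
    -- if the action can lead back to the region where the delay ends, then the shadow executes it
    -- together with the delay
    by_cases hfin : (c.advance Δ).Arrived Δ ∧ ∃ t, c.hist.last.Step p Δ a t ∧ (c.advance Δ).At t
    · obtain ⟨harr', t, ht, hat⟩ := hfin
      refine snoc t ht (hs'.equiv hat) ?_ fun hnt h => absurd (hub hnt).2 h
      rw [htick, harr'.2, ht.z_eq]
      rfl
    · refine ⟨_, .stutter Δ _ e hopp harr (fun h t ht hat => hfin ⟨h, t, ht, hat⟩)
        (fun u hu => hs'.congr hu) htick, fun hnt => ?_⟩
      cases p with
      | controller =>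
        exact fun h => absurd (hub hnt).2 (lazyBlame_controller_iff.1 h).1
      | environment => exact fun _ => not_blamedTo_advance

theorem simulates_silent (hG : G.DeadlockFree) (hc : c.Legit σ)
    (hs : c.At s) (htran : G.RefinedTran s m s') (hm : m p = move σ c s)
    (hself : ¬ c.hist.last.Playing p) : Simulates σ c s m s' := by
  have e := (hc.choose_eq_silent_iff hG).2 hself
  have h0 := hc.off_eq_zero (hG.playing hself)
  have hreg := hs.regionEquiv h0
  rw [move_of_silent hs hc e] at hm
  rcases htran.elim p with ⟨_, _, _, _, h, -⟩ | ⟨_, _, h, -⟩ | ⟨δ, b, -, h2, -, h4⟩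
  · rw [hm] at h; cases h
  · rw [hm] at h; cases h
  obtain ⟨φ, hφ⟩ := hreg.2.exists_isDelayMatch
  obtain ⟨t, ht, het⟩ := h4.transfer hreg.1 hφ
  obtain ⟨n, hn, hn'⟩ := Player.exists_joint (B := fun q => TimedMove (A q)) p
    .silent (.propose (φ δ) b)
  refine .of_snoc (.of_alone_opp hn' hn hself ht) (hn.trans e.symm) het ?_ (fun _ _ h => ?_)
    fun _ h _ => ⟨mt (unblamed_iff hreg het).1 h, by rw [h2]; exact h4⟩
  · rw [h4.z_eq, ht.z_eq, val_of_off_eq_zero h0]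
    exact hφ.tick_iff δ
  · rw [hm] at h
    exact h.elim

theorem simulates_immediate (hG : G.DeadlockFree) (hc : c.Legit σ)
    (hs : c.At s) (htran : G.RefinedTran s m s') (hm : m p = move σ c s)
    (hself : c.hist.last.Playing p) (hopp : c.hist.last.Playing p.opp)
    (e : σ.choose c.hist = .propose Δ a) (hi : c.Immediate p Δ) : Simulates σ c s m s' := by
  have h0 := hc.off_eq_zero hopp
  have hreg := hs.regionEquiv h0
  have hw := hc.canWait hG e
  rw [move_of_immediate hs hc e hi] at hm
  rcases htran.elim p with ⟨_, _, Δ', b, h1, h2, -, -, -, ⟨u, hu⟩, h⟩ | ⟨_, _, -, -, h, -⟩ |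
    ⟨_, _, -, -, h, -⟩
  rotate_left
  · exact absurd (hreg.playing_iff.2 hopp) h
  · exact absurd (hreg.playing_iff.2 hself) h
  rw [hm] at h1
  cases h1
  by_cases hstep : s.Step p 0 a s'
  -- the opponent of the shadow proposes a move that corresponds to the opponent's, after the delay
  -- that the shadow strategy waits within the region
  · have heq := hs.2.trans hi.1.1
    obtain ⟨φ, hφ⟩ := heq.exists_isDelayMatch
    obtain ⟨t, ht, het, hback⟩ := (State.step_zero_iff.1 hstep).transfer heq
    have hst : c.hist.last.Step p Δ a t := State.step_iff.2 ⟨hw, hs.1 ▸ ht⟩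
    have hw' : c.hist.last.CanWait p.opp (Δ + φ Δ') := by
      refine State.CanWait.append hs.1 ⟨hw.1, hi.2 hopp⟩ (fun hΔ => ?_) hφ (State.step_iff.1 hu).1
      have hcl : G.ClockEquiv (c.hist.last.val.delay 0) (c.hist.last.val.delay Δ) := by
        have := hi.1.1
        rwa [val, h0] at this
      rw [← hcl.noWait_delay_iff zero_le le_rfl,
        hcl.noWait_delay_iff (t := Δ / 2) zero_le (half_le_self zero_le)]
      exact hi.2 hopp _ (half_pos hΔ) (half_lt_self hΔ)
    obtain ⟨u', hu', -⟩ := (State.step_iff.1 hu).2.transfer (hφ.clockEquiv Δ')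
    rw [ClockVal.delay_delay] at hu'
    have hsu : c.hist.last.Step p.opp (Δ + φ Δ') b u' := State.step_iff.2 ⟨hw', hs.1 ▸ hu'⟩
    obtain ⟨n, hn, hn'⟩ := Player.exists_joint (B := fun q => TimedMove (A q)) p
      (.propose Δ a) (.propose (Δ + φ Δ') b)
    refine .of_snoc (.of_both hn hn' hself hopp ⟨t, hst⟩ ⟨u', hsu⟩ (.inl ⟨le_self_add, hst⟩))
      (hn.trans e.symm) het ?_
      (fun _ h _ => ⟨mt (unblamed_iff hreg het).2 h, by rw [hn]; exact hst⟩) fun _ h hb => ?_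
    · rw [hstep.z_eq, hst.z_eq, add_zero, hi.1.2]
      exact iff_of_false (lt_irrefl _) (lt_irrefl _)
    · refine ⟨mt (unblamed_iff hreg het).1 h, ?_⟩
      rw [hn'] at hb
      have hz := hb.z_eq.symm.trans hst.z_eq
      have hφ0 : φ Δ' = 0 := by simpa [add_assoc] using hz
      have hΔ' : Δ' = 0 := φ.injective (hφ0.trans φ.map_bot.symm)
      have hf := (State.step_iff.1 hb).2
      rw [hφ0, add_zero, ← hs.1] at hf
      rw [h2, hΔ']
      exact State.step_zero_iff.2 (hback _ _ hf)
  · obtain ⟨hle, h4⟩ := h.resolve_left fun h => hstep h.2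
    have hΔ' : Δ' = 0 := nonpos_iff_eq_zero.1 hle
    subst hΔ'
    obtain ⟨φ, hφ⟩ := hreg.2.exists_isDelayMatch
    have hφ0 : φ 0 = 0 := φ.map_bot
    obtain ⟨t, ht, het⟩ := h4.transfer hreg.1 hφ
    rw [hφ0] at ht
    obtain ⟨n, hn, hn'⟩ := Player.exists_joint (B := fun q => TimedMove (A q)) p
      (.propose Δ a) (.propose 0 b)
    refine .of_snoc (.of_both hn hn' hself hopp (hc.exists_step hG e) ⟨t, ht⟩ (.inr ⟨zero_le, ht⟩))
      (hn.trans e.symm) het ?_ (fun _ _ h => ?_)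
      fun _ h _ => ⟨mt (unblamed_iff hreg het).1 h, by rw [h2]; exact h4⟩
    · rw [h4.z_eq, ht.z_eq, val_of_off_eq_zero h0, add_zero, add_zero]
      exact iff_of_false (lt_irrefl _) (lt_irrefl _)
    · rw [hm] at h
      exact absurd h hstep

theorem simulates_wait (hG : G.DeadlockFree) (hc : c.Legit σ)
    (hs : c.At s) (htran : G.RefinedTran s m s') (hm : m p = move σ c s)
    (hself : c.hist.last.Playing p) (hopp : c.hist.last.Playing p.opp)
    (e : σ.choose c.hist = .propose Δ a) (hi : ¬ c.Immediate p Δ) : Simulates σ c s m s' := by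
  have h0 := hc.off_eq_zero hopp
  have hreg := hs.regionEquiv h0
  have hlt := hc.off_lt e hi
  have hw := hc.canWait hG e
  rw [move_of_not_immediate hs hc e hi] at hm
  rcases htran.elim p with ⟨_, _, Δ', b, h1, h2, -, -, -, ⟨u, hu⟩, h⟩ | ⟨_, _, -, -, h, -⟩ |
    ⟨_, _, -, -, h, -⟩
  rotate_left
  · exact absurd (hreg.playing_iff.2 hopp) h
  · exact absurd (hreg.playing_iff.2 hself) h
  rw [hm] at h1
  cases h1
  have hφ := isDelayMatch_matchIso hs.2
  have hδ := off_add_waitDelay (s := s) hlt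
  rw [h0, zero_add] at hδ
  set φ := matchIso (G := G) s.val c.val
  rw [val_of_off_eq_zero h0] at hφ
  by_cases hstep : s.Step p (c.waitDelay Δ s) none s'
  -- the strategy waits without being interrupted, which the opponent of the shadow can do as well
  · obtain ⟨hloc, hval⟩ := fire_none_iff.1 (State.step_iff.1 hstep).2
    have hle : c.waitDelay Δ s ≤ Δ' := by
      rcases h with h | h
      · exact h.1
      · have := hstep.z_eq.symm.trans h.2.z_eq
        exact (add_left_cancel this).le
    have hw' : c.hist.last.CanWait p.opp (c.target Δ) :=
      hδ ▸ ((State.step_iff.1 hu).1.mono hle).transfer hreg.1 hφ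
    have hst := hw'.step_none
    have het : s'.RegionEquiv (c.hist.last.wait _ hw') :=
      ⟨hloc.trans hreg.1, hval ▸ hs.delay_waitDelay hlt⟩
    have hub : ¬ ⌊s.val.z⌋₊ < ⌊s'.val.z⌋₊ → Unblamed s s' := by
      intro hnt
      by_cases harr : c.Arrived Δ
      · have : ∃ δ, 0 < δ ∧ δ < Δ ∧
            (G.noWait p.opp c.hist.last.loc).Sat (c.hist.last.val.delay δ) := by
          by_contra! hcon
          exact hi ⟨harr, fun _ => hcon⟩
        obtain ⟨δ, hδ0, hδΔ, hsat⟩ := this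
        refine absurd hsat (hw'.2 δ hδ0 ?_)
        -- the next stop can only precede the end of the delay by a tick
        rcases c.target_eq_or Δ with h | ⟨-, h⟩
        · exact h.symm ▸ hδΔ
        · exfalso
          refine hnt ?_
          rw [hval, ClockVal.z_delay, hs.tick_waitDelay_iff hlt]
          change _ < ⌊c.hist.last.val.z + c.target Δ⌋₊
          rw [h]
          have := Nat.floor_natCast (R := ℝ≥0) (⌊c.val.z⌋₊ + 1)
          push_cast at this
          omega
      · exact (unblamed_of_wait hs hlt harr hloc hval hnt).2
    obtain ⟨n, hn, hn'⟩ := Player.exists_joint (B := fun q => TimedMove (A q)) p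
      (.propose Δ a) (.propose (c.target Δ) none)
    refine .of_snoc (.of_both hn hn' hself hopp (hc.exists_step hG e) ⟨_, hst⟩
      (.inr ⟨c.target_le Δ, hst⟩)) (hn.trans e.symm) het ?_ (fun hnt h _ => absurd (hub hnt) h)
      fun hnt h => absurd ((unblamed_iff hreg het).1 (hub hnt)) h
    rw [hval]
    exact hs.tick_waitDelay_iff hlt
  · obtain ⟨hle, h4⟩ := h.resolve_left fun h => hstep h.2
    obtain ⟨t, ht, het⟩ := h4.transfer hreg.1 hφ
    have hle' : φ Δ' ≤ Δ := (φ.monotone hle).trans (hδ.trans_le (c.target_le Δ))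
    obtain ⟨n, hn, hn'⟩ := Player.exists_joint (B := fun q => TimedMove (A q)) p
      (.propose Δ a) (.propose (φ Δ') b)
    refine .of_snoc (.of_both hn hn' hself hopp (hc.exists_step hG e) ⟨t, ht⟩ (.inr ⟨hle', ht⟩))
      (hn.trans e.symm) het ?_ (fun _ _ h => ?_)
      fun _ h _ => ⟨mt (unblamed_iff hreg het).1 h, by rw [h2]; exact h4⟩
    · rw [h4.z_eq, ht.z_eq, val_of_off_eq_zero h0]
      exact hφ.tick_iff _
    · rw [hm] at h
      exact absurd h hstep

/-- A shadow can follow every step of a play in which `p` moves according to the shadow. -/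
theorem simulates (hG : G.DeadlockFree) (hp : G.PlayingBeforeWait p.opp) (hc : c.Legit σ)
    (hs : c.At s) (htran : G.RefinedTran s m s') (hm : m p = move σ c s) :
    Simulates σ c s m s' := by
  by_cases hopp : c.hist.last.Playing p.opp
  · by_cases hself : c.hist.last.Playing p
    · obtain ⟨Δ, a, e⟩ := hc.exists_choose_eq hG hself
      by_cases hi : c.Immediate p Δ
      · exact simulates_immediate hG hc hs htran hm hself hopp e hi
      · exact simulates_wait hG hc hs htran hm hself hopp e hi
    · exact simulates_silent hG hc hs htran hm hself
  · exact simulates_alone hG hp hc hs htran hm hopp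

end Shadow

end TimedArena

/-! ### Plays as limits of histories -/

section limit

variable {S : Type*} {M : Player → Type*}

/-- The number of steps of a history. -/
def History.length : History S M → ℕ
  | .init _ => 0
  | .snoc h _ _ => h.length + 1

@[simp] theorem Play.length_upTo (ρ : Play S M) (i : ℕ) : (ρ.upTo i).length = i := by
  induction i with
  | zero => rfl
  | succ i ih => exact congrArg (· + 1) ih

@[simp] theorem Play.last_upTo (ρ : Play S M) (i : ℕ) : (ρ.upTo i).last = ρ.state i := by
  cases i <;> rfl

/-- A sequence of histories that is extended infinitely often, by one step at a time, has a play as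
its limit. -/
theorem exists_play_of_histories {H : ℕ → History S M} {s : S} (h0 : H 0 = .init s)
    (hstep : ∀ n, H (n + 1) = H n ∨ ∃ m t, H (n + 1) = (H n).snoc m t)
    (hinf : ∀ N, ∃ n ≥ N, H (n + 1) ≠ H n) :
    ∃ (ρ : Play S M) (f : ℕ → ℕ), Monotone f ∧ (∀ n, ρ.upTo (f n) = H n) ∧
      ∀ i, ∃ n, f n = i ∧ f (n + 1) = i + 1 := by
  let f : ℕ → ℕ := fun n => (H n).length
  have hf : ∀ n, H (n + 1) = H n ∧ f (n + 1) = f n ∨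
      (∃ m t, H (n + 1) = (H n).snoc m t) ∧ f (n + 1) = f n + 1 := fun n =>
    (hstep n).imp (fun h => ⟨h, congrArg History.length h⟩)
      fun ⟨m, t, h⟩ => ⟨⟨m, t, h⟩, congrArg History.length h⟩
  have hmono : Monotone f := monotone_nat_of_le_succ fun n => by rcases hf n with h | h <;> omega
  have hconst : ∀ m n, f m = f n → H m = H n := by
    have : ∀ m k, f m = f (m + k) → H m = H (m + k) := by
      intro m k
      induction k with
      | zero => exact fun _ => rfl
      | succ k ih =>
        intro h
        have h1 : f m ≤ f (m + k) := hmono (by omega)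
        rcases hf (m + k) with h2 | h2 <;> rw [← add_assoc] at h ⊢
        · rw [h2.1]; exact ih (h.trans h2.2)
        · omega
    intro m n h
    rcases le_total m n with hmn | hmn <;> obtain ⟨k, rfl⟩ := Nat.exists_eq_add_of_le hmn
    · exact this _ _ h
    · exact (this _ _ h.symm).symm
  have hunb : ∀ i, ∃ n, i < f n := by
    intro i
    induction i with
    | zero =>
      obtain ⟨n, -, hn⟩ := hinf 0
      exact ⟨n + 1, by have := (hf n).resolve_left fun h => hn h.1; omega⟩
    | succ i ih =>
      obtain ⟨n, hn⟩ := ih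
      obtain ⟨k, hk, hne⟩ := hinf n
      have h1 := (hf k).resolve_left fun h => hne h.1
      exact ⟨k + 1, by have := hmono hk; omega⟩
  have hjump : ∀ i, ∃ n, f n = i ∧ ∃ m t, H (n + 1) = (H n).snoc m t := by
    intro i
    classical
    obtain ⟨k, hk⟩ : ∃ k, Nat.find (hunb i) = k + 1 := by
      refine Nat.exists_eq_succ_of_ne_zero fun h => ?_
      have := Nat.find_spec (hunb i)
      rw [h] at this
      simp [f, h0, History.length] at this
    have h1 := Nat.find_spec (hunb i)
    have h2 := Nat.find_min (hunb i) (m := k) (by omega)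
    rw [hk] at h1
    rcases hf k with h | h
    · omega
    · exact ⟨k, by omega, h.1⟩
  choose k hk m t hmt using hjump
  let ρ : Play S M := ⟨fun i => Nat.casesOn i s t, m⟩
  have hk' : ∀ i, f (k i + 1) = i + 1 := fun i =>
    (congrArg History.length (hmt i)).trans (congrArg (· + 1) (hk i))
  have hup : ∀ i, ρ.upTo i = H (k i) := by
    intro i
    induction i with
    | zero =>
      rw [hconst (k 0) 0 ((hk 0).trans (by simp [f, h0, History.length])), h0]
      rfl
    | succ i ih =>
      rw [hconst (k (i + 1)) (k i + 1) ((hk _).trans (hk' i).symm), hmt, ← ih]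
      rfl
  refine ⟨ρ, f, hmono, fun n => ?_, fun i => ⟨k i, hk i, hk' i⟩⟩
  rw [hup]; exact hconst _ _ (hk _)

theorem tendsto_atTop_of_jump {f : ℕ → ℕ} (hmono : Monotone f)
    (hjump : ∀ i, ∃ n, f n = i ∧ f (n + 1) = i + 1) : Tendsto f atTop atTop :=
  tendsto_atTop_atTop_of_monotone hmono fun b =>
    let ⟨n, hn, _⟩ := hjump b
    ⟨n, hn.ge⟩

/-- Only the indices at which `f` jumps matter: there is exactly one of them for each `i`. -/
theorem frequently_comp_and_jump_iff {f : ℕ → ℕ} (hmono : Monotone f)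
    (hjump : ∀ i, ∃ n, f n = i ∧ f (n + 1) = i + 1) {P : ℕ → Prop} :
    (∃ᶠ n in atTop, P (f n) ∧ f (n + 1) = f n + 1) ↔ ∃ᶠ i in atTop, P i := by
  constructor
  · exact fun h => (tendsto_atTop_of_jump hmono hjump).frequently (h.mono fun _ h => h.1)
  · intro h
    rw [frequently_atTop] at h ⊢
    intro N
    obtain ⟨i, hi, hPi⟩ := h (f N + 1)
    obtain ⟨n, rfl, hn⟩ := hjump i
    refine ⟨n, ?_, hPi, hn⟩
    by_contra! hlt
    have := hmono hlt.le
    omega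

theorem frequently_comp_iff {f : ℕ → ℕ} (hmono : Monotone f)
    (hjump : ∀ i, ∃ n, f n = i ∧ f (n + 1) = i + 1) {P : ℕ → Prop} :
    (∃ᶠ n in atTop, P (f n)) ↔ ∃ᶠ i in atTop, P i := by
  exact ⟨(tendsto_atTop_of_jump hmono hjump).frequently,
    fun h => ((frequently_comp_and_jump_iff hmono hjump).2 h).mono fun _ h => h.1⟩

/-- An increasing sequence is unbounded if and only if it passes integers infinitely often. -/
theorem unbounded_iff_frequently_floor_lt {w : ℕ → ℝ≥0} (hw : Monotone w) :
    (∀ t, ∃ n, t < w n) ↔ ∃ᶠ n in atTop, ⌊w n⌋₊ < ⌊w (n + 1)⌋₊ := by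
  constructor
  · intro h
    by_contra hcon
    rw [not_frequently, eventually_atTop] at hcon
    obtain ⟨N, hN⟩ := hcon
    have hle : ∀ n, ⌊w (N + n)⌋₊ ≤ ⌊w N⌋₊ := by
      intro n
      induction n with
      | zero => exact le_rfl
      | succ n ih => exact (not_lt.1 (hN (N + n) (by omega))).trans ih
    obtain ⟨n, hn⟩ := h (⌊w N⌋₊ + 1)
    have h1 : w n ≤ w (N + n) := hw (by omega)
    have h2 : ⌊w N⌋₊ + 1 ≤ ⌊w (N + n)⌋₊ :=
      Nat.le_floor (by push_cast; exact hn.le.trans h1)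
    have := hle n
    omega
  · intro h t
    have key : ∀ k : ℕ, ∃ n, k ≤ ⌊w n⌋₊ := by
      intro k
      induction k with
      | zero => exact ⟨0, Nat.zero_le _⟩
      | succ k ih =>
        obtain ⟨n, hn⟩ := ih
        obtain ⟨i, hi, hlt⟩ := frequently_atTop.1 h n
        have := Nat.floor_mono (hw hi)
        exact ⟨i + 1, by omega⟩
    obtain ⟨n, hn⟩ := key (⌊t⌋₊ + 1)
    have h1 : ((⌊t⌋₊ + 1 : ℕ) : ℝ≥0) ≤ ⌊w n⌋₊ := by exact_mod_cast hn
    push_cast at h1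
    exact ⟨n, (Nat.lt_floor_add_one t).trans_le (h1.trans (Nat.floor_le zero_le))⟩

end limit

namespace TimedArena

variable {Q X : Type*} {A : Player → Type*} {G : TimedArena Q X A}

/-- A winning strategy wins all plays that follow it: the opponent has a strategy that produces the
given play. -/
theorem mem_objective_of_isWinning (hG : G.DeadlockFree) {p : Player}
    {σ : G.refinedTS.Strategy p} {s : G.State} (hσ : G.refinedGame.IsWinning s σ)
    {ρ : Play G.State fun p => TimedMove (A p)} (hplay : G.refinedTS.IsPlay ρ)
    (h0 : ρ.state 0 = s) (h : ∀ i, ρ.move i p = σ.choose (ρ.upTo i)) :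
    ρ ∈ G.refinedGame.objective p := by
  classical
  have hdef : ∀ s : G.State, ∃ x, x ∈ G.refinedTS.moves p.opp s := by
    intro s
    by_cases hs : s.Playing p.opp
    · exact ⟨_, (mem_moves_iff hG).2
        (.inl ⟨hs, 0, none, _, rfl, (State.canWait_zero p.opp s).step_none⟩)⟩
    · exact ⟨_, (mem_moves_iff hG).2 (.inr ⟨hs, rfl⟩)⟩
  let τ : G.refinedTS.Strategy p.opp :=
    { choose := fun h => if h = ρ.upTo h.length then ρ.move h.length p.opp else (hdef h.last).choose
      available := fun h _ => by
        split_ifs with e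
        · rw [e, Play.last_upTo, Play.length_upTo]
          exact ⟨ρ.move _, ρ.state _, rfl, hplay _⟩
        · exact (hdef h.last).choose_spec }
  obtain ⟨θ, hθ, hθ'⟩ := Player.exists_joint (B := fun q => G.refinedTS.Strategy q) p σ τ
  refine hσ θ hθ ⟨hplay, h0, fun i => ?_⟩
  refine (Player.forall_iff (P := fun q => ρ.move i q = (θ q).choose (ρ.upTo i)) p).2 ⟨?_, ?_⟩
  · rw [hθ]; exact h i
  · rw [hθ']; simp [τ]

theorem RefinedTran.z_le {s s' : G.State} {m : ∀ p, TimedMove (A p)} (h : G.RefinedTran s m s') :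
    s.val.z ≤ s'.val.z := by
  cases h with
  | both _ _ Δ a hm hplay hstep j hj hs' => exact hs'.z_eq ▸ le_self_add
  | alone _ _ j Δ a hj hopp hplay hs' => exact hs'.z_eq ▸ le_self_add

namespace Shadow

variable {p : Player} {σ : G.refinedTS.Strategy p} {c c' : G.Shadow} {tick : Prop}
  {r : Set G.State} {s s₀ s' : G.State} {m : ∀ p, TimedMove (A p)}

/-! ### The sequence of shadow positions along a play -/

theorem Succ.hist_eq_or (h : Succ σ c tick r c') :
    (∃ Δ a, σ.choose c.hist = .propose Δ a ∧ ¬ c.Arrived Δ ∧ c' = c.advance Δ) ∨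
    ∃ m t, c'.hist = c.hist.snoc m t ∧ c'.off = 0 ∧ G.RefinedTran c.hist.last m t ∧
      m p = σ.choose c.hist := by
  cases h with
  | snoc m t htran hm hr htick => exact .inr ⟨m, t, rfl, rfl, htran, hm⟩
  | stutter Δ a hσ hopp harr hfin hr htick => exact .inl ⟨Δ, a, hσ, harr, rfl⟩

theorem Succ.z_le (h : Succ σ c tick r c') (hc : c.Legit σ) : c.val.z ≤ c'.val.z := by
  cases h with
  | snoc m t htran hm hr htick =>
    change _ ≤ t.val.z + 0
    rw [add_zero]
    rcases (zero_le (a := c.off)).eq_or_lt with h0 | h0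
    · rw [val_of_off_eq_zero h0.symm]
      exact htran.z_le
    · obtain ⟨hopp, Δ, a, e, hle, -⟩ := hc.of_pos h0
      rw [e] at hm
      rcases htran.elim p with ⟨_, _, _, _, -, -, -, h, -⟩ | ⟨Δ', a', h, -, -, hstep⟩ |
        ⟨_, _, h, -⟩
      · exact absurd h hopp
      · rw [hm] at h
        cases h
        rw [hstep.z_eq, val_z]
        gcongr
      · rw [hm] at h; cases h
  | stutter Δ a hσ hopp harr hfin hr htick =>
    have hlt : c.off < Δ := (hc.off_le hσ).lt_of_ne fun e => harr (e ▸ c.arrived_self)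
    change _ ≤ c.hist.last.val.z + c.target Δ
    rw [val_z]
    gcongr
    exact (lt_target hlt).le

/-- The shadow history is extended again and again: while it is not, every step is a tick, but the
last proposal of the shadow strategy has a bounded delay. -/
theorem exists_hist_ne {c : ℕ → G.Shadow} {tick : ℕ → Prop} {r : ℕ → Set G.State}
    (hc : ∀ n, (c n).Legit σ) (h : ∀ n, Succ σ (c n) (tick n) (r n) (c (n + 1))) (N : ℕ) :
    ∃ n ≥ N, (c (n + 1)).hist ≠ (c n).hist := by
  by_contra! hcon
  have hconst : ∀ k, (c (N + k)).hist = (c N).hist := by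
    intro k
    induction k with
    | zero => rfl
    | succ k ih => exact (hcon (N + k) (by omega)).trans ih
  have hst : ∀ k, ∃ Δ a, σ.choose (c N).hist = .propose Δ a ∧ ¬ (c (N + k)).Arrived Δ ∧
      c (N + k + 1) = (c (N + k)).advance Δ := by
    intro k
    rcases (h (N + k)).hist_eq_or with h1 | ⟨m, t, h1, -⟩
    · rwa [hconst k] at h1
    · exact absurd ((hcon (N + k) (by omega)).symm.trans h1) (History.ne_snoc _ _ _)
  obtain ⟨Δ, a, e, -⟩ := hst 0
  have hst : ∀ k, ¬ (c (N + k)).Arrived Δ ∧ c (N + k + 1) = (c (N + k)).advance Δ := by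
    intro k
    obtain ⟨Δ', a', e', h'⟩ := hst k
    rw [e] at e'
    cases e'
    exact h'
  have hgrow : ∀ k, k ≤ ⌊(c (N + k)).val.z⌋₊ := by
    intro k
    induction k with
    | zero => exact Nat.zero_le _
    | succ k ih =>
      have h1 := (hst k).2
      have h2 := (hst (k + 1)).1
      rw [← add_assoc, h1] at h2 ⊢
      rcases (c (N + k)).target_eq_or Δ with h3 | ⟨-, h3⟩
      · refine absurd ?_ h2
        have := ((c (N + k)).advance Δ).arrived_self
        rwa [advance, h3] at this ⊢
      · have h4 : ((c (N + k)).advance Δ).val.z = ⌊(c (N + k)).val.z⌋₊ + 1 := h3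
        rw [h4]
        have := Nat.floor_natCast (R := ℝ≥0) (⌊(c (N + k)).val.z⌋₊ + 1)
        push_cast at this
        omega
  have h1 := hgrow (⌊(c N).hist.last.val.z + Δ⌋₊ + 1)
  have h2 : (c (N + (⌊(c N).hist.last.val.z + Δ⌋₊ + 1))).val.z ≤ (c N).hist.last.val.z + Δ := by
    have hle := (hc (N + (⌊(c N).hist.last.val.z + Δ⌋₊ + 1))).off_le (Δ := Δ) (a := a)
      (by rw [hconst]; exact e)
    rw [val_z, hconst]
    gcongr
  have := Nat.floor_mono h2
  omega

open Classical in
/-- A choice of a position to which the shadow moves, if possible by a step whose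
blame is to the disadvantage of `p`, as the play must not fare worse than its shadow. The choice
depends on the region that the play enters and on the tick only. -/
noncomputable def next (σ : G.refinedTS.Strategy p) (c : G.Shadow) (tick : Prop)
    (r : Set G.State) : G.Shadow :=
  if h : ∃ c', Succ σ c tick r c' ∧ Adverse p (c.BlamedTo c') then h.choose
  else if h : ∃ c', Succ σ c tick r c' then h.choose else c

theorem Simulates.next_spec (h : Simulates σ c s m s') :
    Succ σ c (⌊s.val.z⌋₊ < ⌊s'.val.z⌋₊) s'.region
      (next σ c (⌊s.val.z⌋₊ < ⌊s'.val.z⌋₊) s'.region) ∧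
    (¬ ⌊s.val.z⌋₊ < ⌊s'.val.z⌋₊ → Adverse p (G.lazyBlame s m s' = some .controller) →
      Adverse p (c.BlamedTo (next σ c (⌊s.val.z⌋₊ < ⌊s'.val.z⌋₊) s'.region))) := by
  obtain ⟨c', h1, h2⟩ := h
  unfold next
  split_ifs with h3 h4
  · exact ⟨h3.choose_spec.1, fun _ _ => h3.choose_spec.2⟩
  · exact ⟨h4.choose_spec, fun hn hf => absurd ⟨c', h1, h2 hn hf⟩ h3⟩
  · exact absurd ⟨c', h1⟩ h4

/-- The shadow position after a history. -/
noncomputable def follow (σ : G.refinedTS.Strategy p) (s₀ : G.State) :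
    (History G.State fun p => TimedMove (A p)) → G.Shadow
  | .init _ => ⟨.init s₀, 0⟩
  | .snoc h _ s => next σ (follow σ s₀ h) (⌊h.last.val.z⌋₊ < ⌊s.val.z⌋₊) s.region

theorem _root_.TimedArena.HistoryRegionEquiv.last
    {h₁ h₂ : History G.State fun p => TimedMove (A p)} (h : HistoryRegionEquiv h₁ h₂) :
    h₁.last.RegionEquiv h₂.last := by
  cases h₁ <;> cases h₂
  · exact h
  · exact h.elim
  · exact h.elim
  · exact h.2

variable [Finite X]

theorem _root_.TimedArena.State.RegionEquiv.region_eq {t : G.State} (h : s.RegionEquiv t) :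
    s.region = t.region :=
  Set.ext fun _ => ⟨h.symm.trans, h.trans⟩

theorem follow_congr (σ : G.refinedTS.Strategy p) (s₀ : G.State)
    {h₁ h₂ : History G.State fun p => TimedMove (A p)} (h : HistoryRegionEquiv h₁ h₂)
    (ht : ticks h₁ = ticks h₂) : follow σ s₀ h₁ = follow σ s₀ h₂ := by
  induction h₁ generalizing h₂ with
  | init s₁ =>
    cases h₂ with
    | init s₂ => rfl
    | snoc h₂ m s₂ => exact h.elim
  | snoc h₁ m₁ s₁ ih =>
    cases h₂ with
    | init s₂ => exact h.elim
    | snoc h₂ m₂ s₂ =>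
      simp only [ticks, List.cons.injEq, decide_eq_decide] at ht
      simp only [follow]
      rw [ih h.1 ht.2, h.2.region_eq, propext ht.1]

variable [Finite Q]

/-- The strategy that follows a shadow of `σ` from `s₀`. -/
noncomputable def strategy (hG : G.DeadlockFree) (hp : G.PlayingBeforeWait p.opp)
    (σ : G.refinedTS.Strategy p) (s₀ : G.State) : G.refinedTS.Strategy p where
  choose h := move σ (follow σ s₀ h) h.last
  available h _ := move_mem_moves hG hp σ (follow σ s₀ h) h.last

theorem isRegion_strategy (hG : G.DeadlockFree) (hp : G.PlayingBeforeWait p.opp)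
    (σ : G.refinedTS.Strategy p) (s₀ : G.State) : IsRegion (strategy hG hp σ s₀) := by
  intro h₁ h₂ _ _ h ht s₁ hs₁
  have h' := moveStep_move_transfer hG h.last hs₁
  rw [follow_congr σ s₀ h ht] at h'
  exact h'

/-! ### Comparison of a play with its shadow -/

variable {ρ : Play G.State fun p => TimedMove (A p)}

theorem follow_spec (hG : G.DeadlockFree) (hp : G.PlayingBeforeWait p.opp)
    (hplay : G.refinedTS.IsPlay ρ) (h0 : ρ.state 0 = s₀)
    (hρ : ∀ n, ρ.move n p = move σ (follow σ s₀ (ρ.upTo n)) (ρ.state n)) (n : ℕ) :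
    (follow σ s₀ (ρ.upTo n)).Legit σ ∧ (follow σ s₀ (ρ.upTo n)).At (ρ.state n) ∧
    Succ σ (follow σ s₀ (ρ.upTo n)) (⌊(ρ.state n).val.z⌋₊ < ⌊(ρ.state (n + 1)).val.z⌋₊)
      (ρ.state (n + 1)).region (follow σ s₀ (ρ.upTo (n + 1))) ∧
    (¬ ⌊(ρ.state n).val.z⌋₊ < ⌊(ρ.state (n + 1)).val.z⌋₊ →
      Adverse p (G.lazyBlame (ρ.state n) (ρ.move n) (ρ.state (n + 1)) = some .controller) →
      Adverse p ((follow σ s₀ (ρ.upTo n)).BlamedTo (follow σ s₀ (ρ.upTo (n + 1))))) := by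
  have key : ∀ n, (follow σ s₀ (ρ.upTo n)).Legit σ → (follow σ s₀ (ρ.upTo n)).At (ρ.state n) → _ :=
    fun n hc hs => (simulates hG hp hc hs (hplay n) (hρ n)).next_spec
  have e : ∀ n, follow σ s₀ (ρ.upTo (n + 1)) = next σ (follow σ s₀ (ρ.upTo n))
      (⌊(ρ.state n).val.z⌋₊ < ⌊(ρ.state (n + 1)).val.z⌋₊) (ρ.state (n + 1)).region := by
    intro n
    simp only [Play.upTo, follow, Play.last_upTo]
  have inv : (follow σ s₀ (ρ.upTo n)).Legit σ ∧ (follow σ s₀ (ρ.upTo n)).At (ρ.state n) := by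
    induction n with
    | zero =>
      refine ⟨⟨trivial, fun h => absurd h (lt_irrefl _)⟩, ?_, ?_⟩
      · rw [h0]; rfl
      · rw [h0, val_of_off_eq_zero rfl]; exact .refl _
    | succ n ih =>
      have h := key n ih.1 ih.2
      rw [e n]
      exact ⟨h.1.legit ih.1, h.1.at⟩
  refine ⟨inv.1, inv.2, ?_⟩
  rw [e n]
  exact key n inv.1 inv.2

/-- A play in which `p` follows a shadow of a winning strategy is won by `p`. -/
theorem mem_objective_of_shadow (hG : G.DeadlockFree) (hp : G.PlayingBeforeWait p.opp)
    (hσ : G.refinedGame.IsWinning s₀ σ)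
    (hplay : G.refinedTS.IsPlay ρ) (h0 : ρ.state 0 = s₀)
    (hρ : ∀ n, ρ.move n p = move σ (follow σ s₀ (ρ.upTo n)) (ρ.state n)) :
    ρ ∈ G.refinedGame.objective p := by
  have spec := follow_spec hG hp hplay h0 hρ
  set c : ℕ → G.Shadow := fun n => follow σ s₀ (ρ.upTo n) with hcdef
  have hc : ∀ n, (c n).Legit σ := fun n => (spec n).1
  have hat : ∀ n, (c n).At (ρ.state n) := fun n => (spec n).2.1
  have hsucc : ∀ n, Succ σ (c n) _ _ (c (n + 1)) := fun n => (spec n).2.2.1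
  obtain ⟨θ, f, hmono, hup, hjump⟩ := exists_play_of_histories (H := fun n => (c n).hist) (s := s₀)
    rfl (fun n => (hsucc n).hist_eq_or.imp (fun ⟨Δ, a, _, _, h⟩ => by rw [h]; rfl)
      fun ⟨m, t, h, _⟩ => ⟨m, t, h⟩) (exists_hist_ne hc hsucc)
  have hlast : ∀ n, (c n).hist.last = θ.state (f n) := fun n => by
    rw [← hup n, Play.last_upTo]
  -- where the shadow history is extended, the step is one of `θ`
  have hext : ∀ n, f (n + 1) = f n + 1 → (c (n + 1)).hist =
      (c n).hist.snoc (θ.move (f n)) (θ.state (f n + 1)) := fun n hn => by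
    rw [← hup, ← hup, hn]; rfl
  have hθ : ∀ i, G.RefinedTran (θ.state i) (θ.move i) (θ.state (i + 1)) ∧
      θ.move i p = σ.choose (θ.upTo i) ∧
      ∀ n, f n = i → f (n + 1) = i + 1 → (c (n + 1)).off = 0 := by
    have key : ∀ n, f (n + 1) = f n + 1 → (c (n + 1)).off = 0 ∧
        G.RefinedTran (θ.state (f n)) (θ.move (f n)) (θ.state (f n + 1)) ∧
        θ.move (f n) p = σ.choose (θ.upTo (f n)) := by
      intro n hn
      have h1 := hext n hn
      rcases (hsucc n).hist_eq_or with ⟨Δ, a, -, -, h⟩ | ⟨m, t, h2, h3, h4, h5⟩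
      · rw [h] at h1
        exact absurd h1 (History.ne_snoc _ _ _)
      · rw [h1] at h2
        injection h2 with _ hm ht
        rw [hlast n, ← hm, ← ht] at h4
        rw [← hm, ← hup n] at h5
        exact ⟨h3, h4, h5⟩
    intro i
    obtain ⟨n, rfl, hn⟩ := hjump i
    refine ⟨(key n hn).2.1, (key n hn).2.2, fun k hk hk' => (key k (by omega)).1⟩
  have hθplay : G.refinedTS.IsPlay θ := fun i => (hθ i).1
  have hf0 : f 0 = 0 := by
    obtain ⟨n, hn, -⟩ := hjump 0
    have := hmono (Nat.zero_le n)
    omega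
  have hθ0 : θ.state 0 = s₀ := by
    rw [← hf0, ← hlast]; rfl
  have hwin := mem_objective_of_isWinning hG hσ hθplay hθ0 fun i => (hθ i).2.1
  have hcmono : Monotone fun n => (c n).val.z :=
    monotone_nat_of_le_succ fun n => (hsucc n).z_le (hc n)
  have hdiv_ticks : G.TimeDivergent ρ ↔
      ∃ᶠ n in atTop, ⌊(ρ.state n).val.z⌋₊ < ⌊(ρ.state (n + 1)).val.z⌋₊ :=
    unbounded_iff_frequently_floor_lt (w := fun n => (ρ.state n).val.z)
      (monotone_nat_of_le_succ fun n => (hplay n).z_le)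
  have hdiv : G.TimeDivergent ρ ↔ G.TimeDivergent θ := by
    rw [hdiv_ticks]
    have h1 : (∃ᶠ n in atTop, ⌊(ρ.state n).val.z⌋₊ < ⌊(ρ.state (n + 1)).val.z⌋₊) ↔
        ∃ᶠ n in atTop, ⌊(c n).val.z⌋₊ < ⌊(c (n + 1)).val.z⌋₊ :=
      frequently_congr (.of_forall fun n => (hsucc n).tick_iff)
    rw [h1, ← unbounded_iff_frequently_floor_lt hcmono]
    refine forall_congr' fun t => ⟨fun ⟨n, hn⟩ => ?_, fun ⟨i, hi⟩ => ?_⟩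
    · obtain ⟨k, hk, hk'⟩ := hjump (f n)
      have hnk : n ≤ k + 1 := by
        by_contra! hlt
        have := hmono hlt.le
        omega
      refine ⟨f n + 1, hn.trans_le ((hcmono hnk).trans_eq ?_)⟩
      change (c (k + 1)).val.z = _
      rw [val_of_off_eq_zero ((hθ _).2.2 k hk hk'), hlast, hk']
    · obtain ⟨n, rfl, -⟩ := hjump i
      refine ⟨n, hi.trans_le ?_⟩
      rw [val_z, hlast]
      exact le_self_add
  have hparity : G.refinedTS.ParityEven ρ ↔ G.refinedTS.ParityEven θ := by
    have hcol : ∀ n, G.refinedTS.color (ρ.state n) = G.refinedTS.color (θ.state (f n)) := by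
      intro n
      change G.color (ρ.state n).loc = G.color (θ.state (f n)).loc
      rw [(hat n).1, hlast]
    unfold TransitionSystem.ParityEven
    have hfreq : ∀ d, (∃ᶠ n in atTop, G.refinedTS.color (θ.state (f n)) = d) ↔
        ∃ᶠ i in atTop, G.refinedTS.color (θ.state i) = d := fun d =>
      frequently_comp_iff hmono hjump (P := fun i => G.refinedTS.color (θ.state i) = d)
    simp only [hcol, hfreq]
  -- steps in which the shadow stays at the same history do not count as blamed
  have hblame : (∃ᶠ n in atTop, (c n).BlamedTo (c (n + 1))) ↔ G.LazilyBlamed .controller θ := by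
    have : ∀ n, (c n).BlamedTo (c (n + 1)) ↔
        (G.lazyBlame (θ.state (f n)) (θ.move (f n)) (θ.state (f n + 1)) = some .controller) ∧
          f (n + 1) = f n + 1 := by
      intro n
      constructor
      · rintro ⟨m, t, h, hb⟩
        have hn : f (n + 1) = f n + 1 := by
          have h1 := congrArg History.length h
          have h2 := congrArg History.length (hup n)
          have h3 := congrArg History.length (hup (n + 1))
          rw [Play.length_upTo] at h2 h3
          exact h3.trans (h1.trans (congrArg (· + 1) h2.symm))
        refine ⟨?_, hn⟩
        rw [hext n hn] at h
        injection h with _ hm ht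
        rwa [← hlast, hm, ht]
      · rintro ⟨hb, hn⟩
        exact ⟨_, _, hext n hn, by rwa [hlast]⟩
    simp only [this]
    exact frequently_comp_and_jump_iff hmono hjump (P := fun i =>
      G.lazyBlame (θ.state i) (θ.move i) (θ.state (i + 1)) = some .controller)
  have hadv : ¬ G.TimeDivergent ρ → ∀ᶠ n in atTop,
      Adverse p (G.lazyBlame (ρ.state n) (ρ.move n) (ρ.state (n + 1)) = some .controller) →
      Adverse p ((c n).BlamedTo (c (n + 1))) := by
    intro h
    rw [hdiv_ticks, not_frequently] at h
    exact h.mono fun n hn => (spec n).2.2.2 hn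
  cases p with
  | controller =>
    obtain ⟨-, h⟩ := hwin
    refine ⟨hplay, ?_⟩
    rw [hdiv, hparity]
    refine h.imp id fun ⟨h1, h2⟩ => ⟨h1, fun h3 => h2 ?_⟩
    rw [← hblame]
    exact (h3.and_eventually (hadv (mt hdiv.1 h1))).mono fun n hn => hn.2 hn.1
  | environment =>
    rintro ⟨-, h⟩
    refine hwin ⟨hθplay, ?_⟩
    rw [← hdiv, ← hparity]
    refine h.imp id fun ⟨h1, h2⟩ => ⟨h1, fun h3 => h2 ?_⟩
    rw [← hblame] at h3
    exact (h3.and_eventually (hadv h1)).mono fun n hn => by_contra fun h4 => hn.2 h4 hn.1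

end Shadow

end TimedArena

theorem mainTheorem2 {Q X : Type*} {A : Player → Type*} [Finite Q] [Finite X]
    (G : TimedArena Q X A) (hG : G.DeadlockFree)
    (p : Player) (hp : G.PlayingBeforeWait p.opp) (s : G.State)
    (hwin : ∃ σ : G.refinedTS.Strategy p, G.refinedGame.IsWinning s σ) :
    ∃ σ' : G.refinedTS.Strategy p, G.refinedGame.IsWinning s σ' ∧
      TimedArena.IsSplit σ' ∧ TimedArena.IsRegion σ' ∧ TimedArena.IsZStepped σ' := by
  obtain ⟨σ, hσ⟩ := hwin
  refine ⟨TimedArena.Shadow.strategy hG hp σ s, ?_, fun h _ Δ a e => TimedArena.Shadow.move_split e,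
    TimedArena.Shadow.isRegion_strategy hG hp σ s, fun h _ Δ a e => TimedArena.Shadow.move_z_le e⟩
  rintro τ hτ ρ ⟨hplay, h0, hρ⟩
  refine TimedArena.Shadow.mem_objective_of_shadow hG hp hσ hplay h0 fun n => ?_
  rw [hρ n p, hτ]
  change TimedArena.Shadow.move σ _ (ρ.upTo n).last = _
  rw [Play.last_upTo]
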